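/- For $r\ge 1$ and positive integers $k_1,\dots,k_r$ let $$\bar T(k_1,\dots,k_r)=\lim_{N\to\infty}2^r\sum_{0<n_1<\cdots<n_r\le N}\frac{(-1)^{n_r}}{(2n_1-1)^{k_1}(2n_2-2)^{k_2}\cdots(2n_r-r)^{k_r}},$$ and let $W(k,r)=\sum\bar T(k_1,\dots,k_r)$, where the sum is over all $r$-tuples of positive integers with $k_1+\cdots+k_r=k$. Let $\zeta(k)=\sum_{n\ge1}n^{-k}$ for $k\ge2$, let $\bar\zeta(k)=\sum_{n\ge1}(-1)^{n-1}n^{-k}$ for $k\ge1$, and $\bar\zeta(0)=\tfrac12$. For $1\le j\le p$ let $Z(p,p)=1$ and, if $j<p$, $$Z(j,p)=\sum_{k=1}^{p-j}(-2)^k\sum_{j=i_0<i_1<\cdots<i_k=p}\ \prod_{l=1}^k\bar\zeta(2i_l-2i_{l-1}).$$ **Corollary 3.5.** Let $p$ be a positive integer. All the limits $\bar T(k_1,\dots,k_{2p})$ occurring in $W(2p+1,2p)$ exist, and $W(2p+1,2p)$ can be expressed in terms of Riemann zeta values and alternating zeta values: it is a polynomial with rational coefficients in the numbers $\zeta(k)$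 $(k\ge2)$ and $\bar\zeta(k)$ $(k\ge1)$. Explicitly, $$W(2p+1,2p)=(-1)^{p-1}\sum_{j=1}^{p}\left(\frac1{2^{2j-1}}\sum_{i=1}^{j}\bigl(2^{2i+1}-1\bigr)\,\zeta(2i+1)\,\bar\zeta(2j-2i)\right)Z(j,p).$$ -/

import Mathlib

open Filter Topology

noncomputable section

namespace AltMTV

/-- The finite sets `I(k, r)`: all indices `(k₁, …, k_r)` of positive integers
with `k₁ + ⋯ + k_r = k`. -/
def indices (k r : ℕ) : Finset (Fin r → ℕ) :=
  (Finset.Nat.antidiagonalTuple r k).filter fun κ => ∀ j, 1 ≤ κ j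

/-- The strictly increasing sequences `0 < n₁ < ⋯ < n_r ≤ N`. -/
def chains (r N : ℕ) : Finset (Fin r → ℕ) :=
  open Classical in (Fintype.piFinset fun _ => Finset.Icc 1 N).filter StrictMono

/-- Partial sums (over `n_r ≤ N`) of the alternating multiple `T`-value, i.e.
`2^r ∑_{0 < n₁ < ⋯ < n_r ≤ N} (-1)^{n_r} / ((2n₁-1)^{k₁} (2n₂-2)^{k₂} ⋯ (2n_r-r)^{k_r})`.
The indices `j : Fin r` start at `0`, so the usual one-based index is `j + 1`; the sign is
attached to the last one only. -/
def tBarPartial {r : ℕ} (κ : Fin r → ℕ) (N : ℕ) : ℝ :=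
  2 ^ r * ∑ n ∈ chains r N, ∏ j : Fin r,
    (if (j : ℕ) + 1 = r then (-1 : ℝ) ^ n j else 1) / (2 * (n j : ℝ) - ((j : ℝ) + 1)) ^ κ j

/-- The alternating multiple `T`-value `T̄(k₁, …, k_r)`: the limit of the partial sums.
(When `k_r = 1` the series converges only conditionally.) -/
def tBar {r : ℕ} (κ : Fin r → ℕ) : ℝ :=
  limUnder atTop (tBarPartial κ)

/-- The weighted sum `W(k, r) = W₁(k, r)`: the sum of `T̄` over all indices of weight `k` and
depth `r` (all the weights are `binom(k_r - 1, 0) = 1`). -/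
def W (k r : ℕ) : ℝ :=
  ∑ κ ∈ indices k r, tBar κ

/-- The Riemann zeta value `ζ(k) = ∑_{n ≥ 1} 1 / n^k`, used for `k ≥ 2`
(the term at `n = 0` is `1 / 0 = 0`). -/
def zetaVal (k : ℕ) : ℝ :=
  ∑' n : ℕ, 1 / (n : ℝ) ^ k

/-- `zetaVal` agrees with Mathlib's Riemann zeta function. -/
theorem zetaVal_eq {k : ℕ} (hk : 2 ≤ k) : (zetaVal k : ℂ) = riemannZeta k := by
  rw [zeta_nat_eq_tsum_of_gt_one hk, zetaVal]
  push_cast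
  rfl

/-- Partial sums of the alternating zeta series. -/
def zetaBarPartial (k N : ℕ) : ℝ :=
  ∑ n ∈ Finset.Icc 1 N, (-1 : ℝ) ^ (n - 1) / (n : ℝ) ^ k

/-- The alternating zeta value `ζ̄(k) = ∑_{n ≥ 1} (-1)^{n-1} / n^k` for `k ≥ 1`, as the limit of
the partial sums, with the convention `ζ̄(0) = 1/2`. -/
def zetaBar (k : ℕ) : ℝ :=
  if k = 0 then 1 / 2 else limUnder atTop (zetaBarPartial k)

/-- The alternating zeta series converges to `zetaBar k` for every `k ≥ 1`. -/
theorem tendsto_zetaBarPartial {k : ℕ} (hk : 1 ≤ k) :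
    Tendsto (zetaBarPartial k) atTop (𝓝 (zetaBar k)) := by
  have hk0 : k ≠ 0 := by omega
  rw [zetaBar, if_neg hk0]
  apply tendsto_nhds_limUnder
  have hanti : Antitone fun n : ℕ => 1 / ((n : ℝ) + 1) ^ k := by
    intro a b hab
    have hab' : (a : ℝ) ≤ b := by exact_mod_cast hab
    dsimp only
    gcongr
  have hlim : Tendsto (fun n : ℕ => 1 / ((n : ℝ) + 1) ^ k) atTop (𝓝 0) := by
    have h := (tendsto_one_div_add_atTop_nhds_zero_nat (𝕜 := ℝ)).pow k
    simpa [hk0] using h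
  obtain ⟨l, hl⟩ := hanti.tendsto_alternating_series_of_tendsto_zero hlim
  refine ⟨l, hl.congr fun N => ?_⟩
  rw [zetaBarPartial, Finset.range_eq_Ico, ← Finset.Ico_succ_right_eq_Icc,
    Finset.sum_Ico_eq_sum_range, Finset.sum_Ico_eq_sum_range]
  refine Finset.sum_congr (by simp) fun n _ => ?_
  simp [div_eq_mul_inv, add_comm]

/-- The chains `j = i₀ < i₁ < ⋯ < i_k = p`. -/
def linkedChains (k j p : ℕ) : Finset (Fin (k + 1) → ℕ) :=
  open Classical in (Fintype.piFinset fun _ => Finset.Icc j p).filter fun i =>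
    StrictMono i ∧ i 0 = j ∧ i (Fin.last k) = p

/-- The numbers `Z(j, p)` for `1 ≤ j ≤ p`:
`Z(j, p) = ∑_{k=1}^{p-j} (-2)^k ∑_{j = i₀ < i₁ < ⋯ < i_k = p} ∏_{l=1}^k ζ̄(2 i_l - 2 i_{l-1})`
for `j < p`, and `Z(p, p) = 1`. -/
def Z (j p : ℕ) : ℝ :=
  if j = p then 1
  else ∑ k ∈ Finset.Icc 1 (p - j), (-2 : ℝ) ^ k *
    ∑ i ∈ linkedChains k j p, ∏ l : Fin k, zetaBar (2 * i l.succ - 2 * i l.castSucc)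

end AltMTV

end

/-! Put n_r = r + k, so that 2n_r - r = r + 2k, and replace the final summation by a power series in
t with terms (-1)^(r+k) c_k t^(r+2k) (`altSeries`). With all exponents 1 the series is (-2 arctan
t)^r / r!. Let D_r be the sum of the series over the r positions of a single exponent 2. Then
D_{r+1}' = -2 D_r / (1+t²) + (-2 arctan t)^(r+1) / ((r+1)! t), and t = tan(θ/2) turns this into
dD_{r+1}/dθ = -D_r + (-θ)^(r+1) / ((r+1)! sin θ).

Weighting the D_r by divided powers of θ - π/2 makes the recursive terms cancel
(`hasDerivAt_primitive`). At θ = π/2 only the top depth survives, and Abel's theorem identifies it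
with W. Hence (`integral_kernelFun`) W(2p+1,2p) = ∫_0^{π/2} ((π/2)^{2p} - (π/2-θ)^{2p}) / ((2p)! sin
θ) dθ. Expanding 1/sin θ as 2 Σ sin((2q+1)θ), justified by the Riemann–Lebesgue lemma, and
integrating by parts gives W as a combination of odd zeta values with coefficients (π/2)^{2n}/(2n)!
up to sign (`W_eq_sum_zetaVal`).

The powers of π are then recognised by generating functions: 2ζ̄(2n) are the coefficients of πx/sin
πx, Z(p-n,p) those of its inverse sin πx/(πx) (`Z_sub`), and (πx/2)/sin(πx/2) · sin πx/(πx) =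
cos(πx/2) (`sum_zetaBar_mul_Z`). -/

namespace AltMTV

/-! ### Even alternating zeta values and the series πx/sin πx -/

section BernoulliSeries

open PowerSeries

/-- The exponential generating series of the numbers `B_n(1/2)`. -/
noncomputable def halfBernoulliSeries : ℝ⟦X⟧ :=
  mk fun n => Polynomial.aeval (1 / 2 : ℝ) ((1 / n.factorial : ℚ) • Polynomial.bernoulli n)

theorem halfBernoulliSeries_mul_sinh :
    halfBernoulliSeries *
      (rescale (1 / 2 : ℝ) (exp ℝ) - rescale (-(1 / 2) : ℝ) (exp ℝ)) = X := by
  have h := Polynomial.bernoulli_generating_function (1 / 2 : ℝ)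
  have h1 : exp ℝ * rescale (-(1 / 2) : ℝ) (exp ℝ) = rescale (1 / 2 : ℝ) (exp ℝ) := by
    have := exp_mul_exp_eq_exp_add (1 : ℝ) (-(1 / 2) : ℝ)
    rw [rescale_one, RingHom.id_apply] at this
    rw [this]; norm_num
  have h2 : rescale (1 / 2 : ℝ) (exp ℝ) * rescale (-(1 / 2) : ℝ) (exp ℝ) = 1 := by
    rw [exp_mul_exp_eq_exp_add, add_neg_cancel, rescale_zero]
    simp
  calc halfBernoulliSeries *
        (rescale (1 / 2 : ℝ) (exp ℝ) - rescale (-(1 / 2) : ℝ) (exp ℝ))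
      = halfBernoulliSeries * (exp ℝ - 1) * rescale (-(1 / 2) : ℝ) (exp ℝ) := by
        rw [← h1]; ring
    _ = X := by
        rw [halfBernoulliSeries, h, mul_assoc, h2, mul_one]

/-- Substitute X/2 for X in the previous identity and use sinh(X/2) = 2 sinh(X/4) cosh(X/4). -/
theorem rescale_halfBernoulliSeries_mul_sinh :
    rescale (1 / 2 : ℝ) halfBernoulliSeries *
      (rescale (1 / 2 : ℝ) (exp ℝ) - rescale (-(1 / 2) : ℝ) (exp ℝ)) =
    X * (C (1 / 2 : ℝ) *
      (rescale (1 / 4 : ℝ) (exp ℝ) + rescale (-(1 / 4) : ℝ) (exp ℝ))) := by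
  have h := congrArg (rescale (1 / 2 : ℝ)) halfBernoulliSeries_mul_sinh
  rw [map_mul, map_sub, rescale_X, rescale_rescale, rescale_rescale] at h
  have e1 : (1 / 2 * (1 / 2) : ℝ) = 1 / 4 := by norm_num
  have e2 : (-(1 / 2) * (1 / 2) : ℝ) = -(1 / 4) := by norm_num
  rw [e1, e2] at h
  have h1 : rescale (1 / 2 : ℝ) (exp ℝ) = rescale (1 / 4 : ℝ) (exp ℝ) ^ 2 := by
    rw [sq, exp_mul_exp_eq_exp_add]; norm_num
  have h2 : rescale (-(1 / 2) : ℝ) (exp ℝ) = rescale (-(1 / 4) : ℝ) (exp ℝ) ^ 2 := by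
    rw [sq, exp_mul_exp_eq_exp_add]; norm_num
  rw [h1, h2]
  linear_combination
    (rescale (1 / 4 : ℝ) (exp ℝ) + rescale (-(1 / 4) : ℝ) (exp ℝ)) * h

theorem sum_range_two_mul {M : Type*} [AddCommMonoid M] (f : ℕ → M) (n : ℕ) :
    ∑ i ∈ Finset.range (2 * n), f i = ∑ i ∈ Finset.range n, (f (2 * i) + f (2 * i + 1)) := by
  induction n with
  | zero => simp
  | succ n ih =>
    rw [show 2 * (n + 1) = 2 * n + 1 + 1 by ring, Finset.sum_range_succ, Finset.sum_range_succ, ih,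
      Finset.sum_range_succ _ n, add_assoc]

theorem coeff_exp_rescale (a : ℝ) (n : ℕ) :
    coeff n (rescale a (exp ℝ)) = a ^ n / n.factorial := by
  rw [coeff_rescale, coeff_exp]
  simp [div_eq_mul_inv]

/-- The second factor is odd, so an odd coefficient of the product sees only even coefficients of
`P`. -/
theorem coeff_mul_sinh (P : ℝ⟦X⟧) (a : ℝ) (n : ℕ) :
    coeff (2 * n + 1) (P * (rescale a (exp ℝ) - rescale (-a) (exp ℝ))) =
      ∑ i ∈ Finset.range (n + 1), coeff (2 * i) P *
        (2 * a ^ (2 * (n - i) + 1) / (2 * (n - i) + 1).factorial) := by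
  rw [coeff_mul, Finset.Nat.sum_antidiagonal_eq_sum_range_succ_mk,
    show (2 * n + 1).succ = 2 * (n + 1) by omega, sum_range_two_mul]
  refine Finset.sum_congr rfl fun i hi => ?_
  have hi' : i ≤ n := by simpa [Nat.lt_succ_iff] using hi
  have e1 : 2 * n + 1 - 2 * i = 2 * (n - i) + 1 := by omega
  have e2 : 2 * n + 1 - (2 * i + 1) = 2 * (n - i) := by omega
  simp only [e1, e2, map_sub, coeff_exp_rescale]
  rw [Odd.neg_pow ⟨n - i, rfl⟩, Even.neg_pow ⟨n - i, by ring⟩]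
  ring

theorem sum_halfBernoulli (n : ℕ) :
    ∑ i ∈ Finset.range (n + 1), coeff (2 * i) halfBernoulliSeries *
        (2 * (1 / 2 : ℝ) ^ (2 * (n - i) + 1) / (2 * (n - i) + 1).factorial) =
      if n = 0 then 1 else 0 := by
  rw [← coeff_mul_sinh, halfBernoulliSeries_mul_sinh, coeff_X]
  simp

theorem sum_rescale_halfBernoulli (n : ℕ) :
    ∑ i ∈ Finset.range (n + 1), (1 / 2 : ℝ) ^ (2 * i) * coeff (2 * i) halfBernoulliSeries *
        (2 * (1 / 2 : ℝ) ^ (2 * (n - i) + 1) / (2 * (n - i) + 1).factorial) =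
      (1 / 4) ^ (2 * n) / (2 * n).factorial := by
  have := coeff_mul_sinh (rescale (1 / 2 : ℝ) halfBernoulliSeries) (1 / 2) n
  simp only [coeff_rescale _ (1 / 2 : ℝ)] at this
  rw [← this, rescale_halfBernoulliSeries_mul_sinh, coeff_succ_X_mul, coeff_C_mul, map_add,
    coeff_exp_rescale, coeff_exp_rescale, Even.neg_pow ⟨n, by ring⟩]
  ring

theorem tendsto_sum_Icc_of_hasSum {f : ℕ → ℝ} {l : ℝ} (h0 : f 0 = 0) (h : HasSum f l) :
    Tendsto (fun N => ∑ n ∈ Finset.Icc 1 N, f n) atTop (𝓝 l) := by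
  refine ((tendsto_add_atTop_iff_nat 1).2 h.tendsto_sum_nat).congr fun N => ?_
  rw [Finset.sum_range_succ', h0, add_zero, ← Finset.Ico_succ_right_eq_Icc,
    Finset.sum_Ico_eq_sum_range]
  simp [add_comm]

/-- The Fourier series of B_{2n}(x) at x = 1/2, where cos(πm) = (-1)^m. The convention ζ̄(0) = 1/2
is exactly what makes n = 0 fit. -/
theorem zetaBar_two_mul (n : ℕ) :
    zetaBar (2 * n) = (-1) ^ n * (2 * Real.pi) ^ (2 * n) / 2 *
      coeff (2 * n) halfBernoulliSeries := by
  rcases Nat.eq_zero_or_pos n with rfl | hn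
  · simp [zetaBar, halfBernoulliSeries]
  · have h := hasSum_one_div_nat_pow_mul_cos hn.ne' (x := 1 / 2) (by norm_num)
    have h' := tendsto_sum_Icc_of_hasSum (by simp [hn.ne']) h.neg
    refine tendsto_nhds_unique (tendsto_zetaBarPartial (by omega)) ?_
    have e : -((-1 : ℝ) ^ (n + 1) * (2 * Real.pi) ^ (2 * n) / 2 / (2 * n).factorial *
        (Polynomial.map (algebraMap ℚ ℝ) (Polynomial.bernoulli (2 * n))).eval (1 / 2)) =
        (-1) ^ n * (2 * Real.pi) ^ (2 * n) / 2 * coeff (2 * n) halfBernoulliSeries := by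
      rw [halfBernoulliSeries, coeff_mk, map_smul, Polynomial.eval_map_algebraMap,
        Rat.smul_def]
      push_cast
      ring
    rw [← e]
    refine h'.congr fun N => Finset.sum_congr rfl fun m hm => ?_
    obtain ⟨k, rfl⟩ : ∃ k, m = k + 1 := ⟨m - 1, by have := (Finset.mem_Icc.1 hm).1; omega⟩
    rw [show 2 * Real.pi * ((k + 1 : ℕ) : ℝ) * (1 / 2) = ((k + 1 : ℕ) : ℝ) * Real.pi by ring,
      Real.cos_nat_mul_pi, Nat.add_sub_cancel]
    ring

/-- Coefficients of (πx/sin πx) · (sin πx/(πx)) = 1, from X = 2πix in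
`halfBernoulliSeries_mul_sinh`. -/
theorem sum_zetaBar_mul_sinc (n : ℕ) :
    ∑ i ∈ Finset.range (n + 1), 2 * zetaBar (2 * i) *
        ((-1) ^ (n - i) * Real.pi ^ (2 * (n - i)) / (2 * (n - i) + 1).factorial) =
      if n = 0 then 1 else 0 := by
  have h := congrArg (fun x : ℝ => (-1) ^ n * (2 * Real.pi) ^ (2 * n) * x) (sum_halfBernoulli n)
  rw [Finset.mul_sum] at h
  have h0 : (-1 : ℝ) ^ n * (2 * Real.pi) ^ (2 * n) * (if n = 0 then 1 else 0) =
      if n = 0 then 1 else 0 := by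
    split_ifs with h
    · simp [h]
    · simp
  rw [h0] at h
  rw [← h]
  refine Finset.sum_congr rfl fun i hi => ?_
  obtain ⟨k, rfl⟩ : ∃ k, n = i + k :=
    Nat.exists_eq_add_of_le (by simpa [Nat.lt_succ_iff] using hi)
  rw [zetaBar_two_mul, Nat.add_sub_cancel_left, mul_add 2 i k, pow_add _ (2 * i) (2 * k),
    mul_pow _ _ (2 * k), pow_succ _ (2 * k), div_pow, one_pow, pow_add _ i k]
  field_simp

/-- Coefficients of (πx/2)/sin(πx/2) · sin πx/(πx) = cos(πx/2). -/
theorem sum_quarter_zetaBar_mul_sinc (n : ℕ) :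
    ∑ i ∈ Finset.range (n + 1), 2 * ((1 / 4) ^ i * zetaBar (2 * i)) *
        ((-1) ^ (n - i) * Real.pi ^ (2 * (n - i)) / (2 * (n - i) + 1).factorial) =
      (-1) ^ n * (Real.pi / 2) ^ (2 * n) / (2 * n).factorial := by
  have h := congrArg (fun x : ℝ => (-1) ^ n * (2 * Real.pi) ^ (2 * n) * x)
    (sum_rescale_halfBernoulli n)
  rw [Finset.mul_sum] at h
  have h0 : (-1 : ℝ) ^ n * (2 * Real.pi) ^ (2 * n) * ((1 / 4) ^ (2 * n) / (2 * n).factorial) =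
      (-1) ^ n * (Real.pi / 2) ^ (2 * n) / (2 * n).factorial := by
    rw [show Real.pi / 2 = 2 * Real.pi * (1 / 4) by ring, mul_pow (2 * Real.pi)]
    ring
  rw [h0] at h
  rw [← h]
  refine Finset.sum_congr rfl fun i hi => ?_
  obtain ⟨k, rfl⟩ : ∃ k, n = i + k :=
    Nat.exists_eq_add_of_le (by simpa [Nat.lt_succ_iff] using hi)
  rw [zetaBar_two_mul, Nat.add_sub_cancel_left, mul_add 2 i k, pow_add _ (2 * i) (2 * k),
    mul_pow _ _ (2 * k), pow_succ _ (2 * k), pow_mul (1 / 2 : ℝ) 2 i, div_pow _ _ (2 * k), one_pow,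
    pow_add _ i k, show (1 / 2 : ℝ) ^ 2 = 1 / 4 by norm_num]
  field_simp

end BernoulliSeries

/-! ### Closed form of Z(j, p) -/

section LinkedChains

theorem mem_linkedChains {k j p : ℕ} {i : Fin (k + 1) → ℕ} :
    i ∈ linkedChains k j p ↔ StrictMono i ∧ i 0 = j ∧ i (Fin.last k) = p := by
  simp only [linkedChains, Finset.mem_filter, Fintype.mem_piFinset, Finset.mem_Icc,
    and_iff_right_iff_imp]
  rintro ⟨h, rfl, rfl⟩ a
  exact ⟨h.monotone (Fin.zero_le a), h.monotone (Fin.le_last a)⟩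

/-- The inner sums in the definition of `Z`. -/
noncomputable def linkedSum (k j p : ℕ) : ℝ :=
  ∑ i ∈ linkedChains k j p, ∏ l : Fin k, zetaBar (2 * i l.succ - 2 * i l.castSucc)

theorem linkedSum_zero (j p : ℕ) : linkedSum 0 j p = if j = p then 1 else 0 := by
  simp only [linkedSum, Finset.univ_eq_empty, Finset.prod_empty, Finset.sum_const, nsmul_one]
  split_ifs with h
  · subst h
    have : linkedChains 0 j j = {fun _ => j} := by
      ext i
      rw [mem_linkedChains, Finset.mem_singleton]
      constructor
      · rintro ⟨-, h, -⟩
        funext a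
        rw [Fin.fin_one_eq_zero a, h]
      · rintro rfl
        exact ⟨Fin.strictMono_iff_lt_succ.2 fun a => a.elim0, rfl, rfl⟩
    simp [this]
  · have : linkedChains 0 j p = ∅ := by
      ext i
      rw [mem_linkedChains]
      simp only [Finset.notMem_empty, iff_false]
      rintro ⟨-, h1, h2⟩
      exact h (h1.symm.trans h2)
    simp [this]

theorem linkedSum_succ (k j p : ℕ) :
    linkedSum (k + 1) j p =
      ∑ m ∈ Finset.Ioc j p, zetaBar (2 * m - 2 * j) * linkedSum k m p := by
  simp only [linkedSum, Finset.mul_sum]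
  rw [Finset.sum_sigma']
  refine Finset.sum_bij' (fun i _ => ⟨i 1, Fin.tail i⟩) (fun x _ => Fin.cons j x.2) ?_ ?_ ?_ ?_ ?_
  · intro i hi
    obtain ⟨h1, h2, h3⟩ := mem_linkedChains.1 hi
    refine Finset.mem_sigma.2 ⟨Finset.mem_Ioc.2 ⟨?_, ?_⟩, mem_linkedChains.2 ⟨?_, rfl, h3⟩⟩
    · rw [← h2]; exact h1 (by simp)
    · rw [← h3]; exact h1.monotone (Fin.le_last _)
    · exact h1.comp (Fin.strictMono_succ)
  · rintro ⟨m, i⟩ hx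
    obtain ⟨hm, hi⟩ := Finset.mem_sigma.1 hx
    obtain ⟨h1, h2, h3⟩ := mem_linkedChains.1 hi
    refine mem_linkedChains.2 ⟨?_, rfl, ?_⟩
    · rw [Fin.strictMono_iff_lt_succ]
      intro a
      refine Fin.cases ?_ (fun b => ?_) a
      · have := (Finset.mem_Ioc.1 hm).1
        have h2' : i 0 = m := h2
        simpa [h2'] using this
      · simpa using h1 (Fin.castSucc_lt_succ (i := b))
    · rw [← Fin.succ_last, Fin.cons_succ, h3]
  · intro i hi
    obtain ⟨h1, h2, h3⟩ := mem_linkedChains.1 hi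
    dsimp only
    rw [← h2, Fin.cons_self_tail]
  · rintro ⟨m, i⟩ hx
    obtain ⟨hm, hi⟩ := Finset.mem_sigma.1 hx
    obtain ⟨h1, h2, h3⟩ := mem_linkedChains.1 hi
    dsimp only at h2 ⊢
    subst h2
    simp only [Fin.tail_cons]
    rfl
  · intro i hi
    obtain ⟨h1, h2, h3⟩ := mem_linkedChains.1 hi
    rw [Fin.prod_univ_succ]
    simp [Fin.tail, h2]

theorem linkedSum_eq_zero {k j p : ℕ} (h : p < j + k) : linkedSum k j p = 0 := by
  induction k generalizing j with
  | zero => rw [linkedSum_zero, if_neg (by omega)]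
  | succ k ih =>
    rw [linkedSum_succ]
    refine Finset.sum_eq_zero fun m hm => ?_
    rw [ih (by have := (Finset.mem_Ioc.1 hm).1; omega), mul_zero]

/-- The k = 0 term absorbs the case j = p, and overlong chains contribute nothing. The free bound
`n` gives all Z(m, p) a common range when sums are exchanged in `Z_rec`. -/
theorem Z_eq_sum_linkedSum {j p n : ℕ} (hjp : j ≤ p) (hn : p < j + n) :
    Z j p = ∑ k ∈ Finset.range n, (-2 : ℝ) ^ k * linkedSum k j p := by
  have h1 : Z j p = ∑ k ∈ Finset.range (p - j + 1), (-2 : ℝ) ^ k * linkedSum k j p := by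
    rw [Z, Finset.sum_range_succ', linkedSum_zero, pow_zero, one_mul]
    split_ifs with h
    · simp [h]
    · rw [add_zero, ← Finset.Ico_succ_right_eq_Icc, Finset.sum_Ico_eq_sum_range]
      refine Finset.sum_congr (by simp) fun k _ => ?_
      rw [add_comm 1 k, linkedSum]
  rw [h1]
  refine Finset.sum_subset (Finset.range_mono (by omega)) fun k _ hk => ?_
  rw [linkedSum_eq_zero (by simp at hk; omega), mul_zero]

theorem Z_self (p : ℕ) : Z p p = 1 := by simp [Z]

theorem Z_rec {j p : ℕ} (hjp : j < p) :
    Z j p = -2 * ∑ m ∈ Finset.Ioc j p, zetaBar (2 * m - 2 * j) * Z m p := by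
  rw [Z_eq_sum_linkedSum hjp.le (n := p + 1) (by omega), Finset.sum_range_succ', linkedSum_zero,
    if_neg hjp.ne, mul_zero, add_zero]
  have : ∀ m ∈ Finset.Ioc j p, zetaBar (2 * m - 2 * j) * Z m p =
      ∑ k ∈ Finset.range p, zetaBar (2 * m - 2 * j) * ((-2 : ℝ) ^ k * linkedSum k m p) := by
    intro m hm
    have := Finset.mem_Ioc.1 hm
    rw [Z_eq_sum_linkedSum this.2 (n := p) (by omega), Finset.mul_sum]
  rw [Finset.sum_congr rfl this, Finset.sum_comm, Finset.mul_sum]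
  refine Finset.sum_congr rfl fun k _ => ?_
  rw [linkedSum_succ, Finset.mul_sum, Finset.mul_sum]
  refine Finset.sum_congr rfl fun m _ => ?_
  ring

/-- `Z_rec` is the recursion for the coefficients of the inverse of Σ 2ζ̄(2n) x^{2n}, whose constant
term is 1; by `sum_zetaBar_mul_sinc` that inverse is sin πx/(πx). -/
theorem Z_sub (p n : ℕ) (hn : n ≤ p) :
    Z (p - n) p = (-1) ^ n * Real.pi ^ (2 * n) / (2 * n + 1).factorial := by
  induction n using Nat.strong_induction_on with
  | _ n ih =>
  rcases Nat.eq_zero_or_pos n with rfl | hpos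
  · simp [Z_self]
  · rw [Z_rec (by omega)]
    have h := sum_zetaBar_mul_sinc n
    rw [if_neg hpos.ne', Finset.sum_range_succ'] at h
    have e0 : 2 * zetaBar (2 * 0) = 1 := by simp [zetaBar]
    rw [e0, one_mul, Nat.sub_zero] at h
    have h2 : ∑ m ∈ Finset.Ioc (p - n) p, zetaBar (2 * m - 2 * (p - n)) * Z m p =
        ∑ i ∈ Finset.range n, zetaBar (2 * (i + 1)) *
        ((-1) ^ (n - (i + 1)) * Real.pi ^ (2 * (n - (i + 1))) /
          (2 * (n - (i + 1)) + 1).factorial) := by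
      refine Finset.sum_nbij' (fun m => m - (p - n) - 1) (fun i => p - n + i + 1) ?_ ?_ ?_ ?_ ?_
      · intro m hm
        have := Finset.mem_Ioc.1 hm
        exact Finset.mem_range.2 (by omega)
      · intro m hm
        have := Finset.mem_range.1 hm
        exact Finset.mem_Ioc.2 (by omega)
      · intro m hm
        have := Finset.mem_Ioc.1 hm
        omega
      · intro m hm
        have := Finset.mem_range.1 hm
        omega
      · intro m hm
        have := Finset.mem_Ioc.1 hm
        have e1 : 2 * (m - (p - n) - 1 + 1) = 2 * m - 2 * (p - n) := by omega
        have e2 : n - (m - (p - n) - 1 + 1) = p - m := by omega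
        rw [e1, e2, ← ih (p - m) (by omega) (by omega), show p - (p - m) = m by omega]
    rw [h2, Finset.mul_sum]
    rw [← sub_eq_zero, ← neg_eq_zero, ← h, neg_sub, sub_eq_add_neg, add_comm _ (-_),
      ← Finset.sum_neg_distrib, add_comm]
    rw [add_comm]
    congr 1
    refine Finset.sum_congr rfl fun i _ => ?_
    ring

theorem sum_zetaBar_mul_Z {i p : ℕ} (hi : i ≤ p) :
    ∑ j ∈ Finset.Icc i p, 1 / 2 ^ (2 * j) * zetaBar (2 * j - 2 * i) * Z j p * 2 =
      1 / 2 ^ (2 * i) * ((-1) ^ (p - i) * (Real.pi / 2) ^ (2 * (p - i)) /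
        (2 * (p - i)).factorial) := by
  rw [← sum_quarter_zetaBar_mul_sinc, Finset.mul_sum]
  refine Finset.sum_nbij' (fun j => j - i) (fun a => i + a) ?_ ?_ ?_ ?_ ?_
  · intro m hm
    have := Finset.mem_Icc.1 hm
    exact Finset.mem_range.2 (by omega)
  · intro m hm
    have := Finset.mem_range.1 hm
    exact Finset.mem_Icc.2 (by omega)
  · intro m hm
    have := Finset.mem_Icc.1 hm
    omega
  · intro m hm
    omega
  · intro m hm
    have := Finset.mem_Icc.1 hm
    obtain ⟨a, rfl⟩ := Nat.exists_eq_add_of_le this.1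
    rw [Nat.add_sub_cancel_left, ← Z_sub p (p - i - a) (by omega),
      show p - (p - i - a) = i + a by omega, show 2 * (i + a) - 2 * i = 2 * a by omega,
      mul_add 2 i a, pow_add, pow_mul 2 2 a, show (1 / 4 : ℝ) ^ a = 1 / (2 ^ 2) ^ a by rw [div_pow, one_pow]; norm_num]
    field_simp

theorem Z_mem {A : Subalgebra ℚ ℝ} (h : ∀ n, zetaBar n ∈ A) (j p : ℕ) : Z j p ∈ A := by
  rw [Z]
  split_ifs
  · exact A.one_mem
  · refine A.sum_mem fun k _ => A.mul_mem (A.pow_mem (A.neg_mem ?_) _) (A.sum_mem fun i _ =>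
      A.prod_mem fun l _ => h _)
    exact_mod_cast A.natCast_mem 2

end LinkedChains

/-! ### Recursions for the terms of the multiple series -/

section Chains

theorem mem_chains {r N : ℕ} {n : Fin r → ℕ} :
    n ∈ chains r N ↔ (∀ j, 1 ≤ n j ∧ n j ≤ N) ∧ StrictMono n := by
  simp [chains]

theorem sum_chains_succ (r N : ℕ) (F : (Fin (r + 1) → ℕ) → ℝ) :
    ∑ n ∈ chains (r + 1) N, F n =
      ∑ m ∈ Finset.Icc 1 N, ∑ n ∈ chains r (m - 1), F (Fin.snoc n m) := by
  rw [Finset.sum_sigma']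
  refine Finset.sum_bij' (fun n _ => ⟨n (Fin.last r), Fin.init n⟩)
    (fun x _ => Fin.snoc (α := fun _ => ℕ) x.2 x.1) ?_ ?_ ?_ ?_ ?_
  · intro n hn
    obtain ⟨h1, h2⟩ := mem_chains.1 hn
    refine Finset.mem_sigma.2 ⟨Finset.mem_Icc.2 (h1 _), mem_chains.2 ⟨fun j => ⟨(h1 _).1, ?_⟩,
      h2.comp Fin.strictMono_castSucc⟩⟩
    exact Nat.le_sub_one_of_lt (h2 (Fin.castSucc_lt_last j))
  · rintro ⟨m, n⟩ hx
    obtain ⟨hm, hn⟩ := Finset.mem_sigma.1 hx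
    obtain ⟨h1, h2⟩ := mem_chains.1 hn
    have hm := Finset.mem_Icc.1 hm
    dsimp only at h1 h2 hm ⊢
    refine mem_chains.2 ⟨fun j => ?_, fun i j hij => ?_⟩
    · refine Fin.lastCases ?_ (fun j => ?_) j
      · simpa using hm
      · have := h1 j
        simp only [Fin.snoc_castSucc]
        omega
    · induction j using Fin.lastCases with
      | last =>
        induction i using Fin.lastCases with
        | last => exact absurd hij (lt_irrefl _)
        | cast i =>
          have := h1 i
          simp only [Fin.snoc_castSucc, Fin.snoc_last]
          omega
      | cast j =>
        induction i using Fin.lastCases with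
        | last => exact absurd hij (not_lt.2 (Fin.le_last _))
        | cast i =>
          simp only [Fin.snoc_castSucc]
          exact h2 (Fin.castSucc_lt_castSucc_iff.1 hij)
  · intro n _
    exact Fin.snoc_init_self n
  · rintro ⟨m, n⟩ _
    simp
  · intro n _
    rw [Fin.snoc_init_self]

theorem chains_eq_empty {r N : ℕ} (h : N < r) : chains r N = ∅ := by
  refine Finset.eq_empty_of_forall_notMem fun n hn => ?_
  obtain ⟨h1, h2⟩ := mem_chains.1 hn
  have := Finset.card_le_card_of_injOn (s := Finset.univ) (t := Finset.Icc 1 N) n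
    (fun j _ => by simpa using h1 j) h2.injective.injOn
  simp at this
  omega

/-- The terms of the multiple `T`-series, without signs, grouped according to `n_r = r + k`. -/
noncomputable def chainCoeff (κ : ℕ → ℕ) : ℕ → ℕ → ℝ
  | 0, k => if k = 0 then 1 else 0
  | r + 1, k => 2 * (∑ i ∈ Finset.range (k + 1), chainCoeff κ r i) / ((r : ℝ) + 1 + 2 * k) ^ κ r

/-- The finite multiple `T`-sums without signs. -/
noncomputable def chainSum (κ : ℕ → ℕ) (r N : ℕ) : ℝ :=
  2 ^ r * ∑ n ∈ chains r N, ∏ j : Fin r, 1 / (2 * (n j : ℝ) - ((j : ℝ) + 1)) ^ κ j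

theorem sum_Icc_one_eq_sum_range (N : ℕ) (f : ℕ → ℝ) :
    ∑ m ∈ Finset.Icc 1 N, f m = ∑ i ∈ Finset.range N, f (i + 1) := by
  rw [← Finset.Ico_succ_right_eq_Icc, Finset.sum_Ico_eq_sum_range]
  simp [add_comm]

theorem chainSum_succ (κ : ℕ → ℕ) (r N : ℕ) :
    chainSum κ (r + 1) N = ∑ i ∈ Finset.range N,
      2 * chainSum κ r i / (2 * ((i : ℝ) + 1) - (r + 1)) ^ κ r := by
  rw [chainSum, sum_chains_succ, sum_Icc_one_eq_sum_range, Finset.mul_sum]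
  refine Finset.sum_congr rfl fun i _ => ?_
  rw [chainSum, Nat.add_sub_cancel, ← mul_assoc, Finset.mul_sum, Finset.mul_sum, Finset.sum_div]
  refine Finset.sum_congr rfl fun n _ => ?_
  rw [Fin.prod_univ_castSucc]
  simp only [Fin.snoc_castSucc, Fin.snoc_last, Fin.val_castSucc, Fin.val_last]
  push_cast
  ring

theorem chainSum_eq_zero {κ : ℕ → ℕ} {r N : ℕ} (h : N < r) : chainSum κ r N = 0 := by
  rw [chainSum, chains_eq_empty h]
  simp

/-- A strict chain has n_r ≥ r, so the sum up to r + K runs over n_r = r + k with k ≤ K. -/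
theorem chainSum_eq_sum_chainCoeff (κ : ℕ → ℕ) (r K : ℕ) :
    chainSum κ r (r + K) = ∑ k ∈ Finset.range (K + 1), chainCoeff κ r k := by
  induction r generalizing K with
  | zero =>
    have : chains 0 (0 + K) = {Fin.elim0} := by
      ext n
      simp only [mem_chains, Finset.mem_singleton]
      exact ⟨fun _ => Subsingleton.elim _ _, fun _ => ⟨fun j => j.elim0, fun j => j.elim0⟩⟩
    rw [chainSum, this]
    simp [chainCoeff]
  | succ r ih =>
    rw [chainSum_succ, show r + 1 + K = r + (K + 1) by ring, Finset.sum_range_add,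
      Finset.sum_eq_zero, zero_add]
    · refine Finset.sum_congr rfl fun k _ => ?_
      rw [ih, chainCoeff]
      push_cast
      ring_nf
    · intro i hi
      rw [chainSum_eq_zero (Finset.mem_range.1 hi)]
      simp

theorem tBarPartial_eq_sum_chainCoeff (κ : ℕ → ℕ) (r K : ℕ) :
    tBarPartial (r := r + 1) (fun j => κ j) (r + K) =
      ∑ k ∈ Finset.range K, (-1) ^ (r + 1 + k) * chainCoeff κ (r + 1) k := by
  have h1 : ∀ N, tBarPartial (r := r + 1) (fun j => κ j) N = ∑ i ∈ Finset.range N,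
      (-1) ^ (i + 1) * (2 * chainSum κ r i / (2 * ((i : ℝ) + 1) - (r + 1)) ^ κ r) := by
    intro N
    rw [tBarPartial, sum_chains_succ, sum_Icc_one_eq_sum_range, Finset.mul_sum]
    refine Finset.sum_congr rfl fun i _ => ?_
    rw [chainSum, Nat.add_sub_cancel, ← mul_assoc, Finset.mul_sum, Finset.mul_sum, Finset.sum_div,
      Finset.mul_sum]
    refine Finset.sum_congr rfl fun n _ => ?_
    rw [Fin.prod_univ_castSucc]
    simp only [Fin.snoc_castSucc, Fin.snoc_last, Fin.val_castSucc, Fin.val_last, if_true]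
    have : ∀ j : Fin r, ((j : ℕ) + 1 = r + 1) ↔ False := fun j => by
      have := j.2
      simp only [iff_false]
      omega
    simp only [this, if_false]
    push_cast
    ring
  rw [h1, Finset.sum_range_add, Finset.sum_eq_zero, zero_add]
  · refine Finset.sum_congr rfl fun k _ => ?_
    rw [chainSum_eq_sum_chainCoeff, chainCoeff]
    push_cast
    ring_nf
  · intro i hi
    rw [chainSum_eq_zero (Finset.mem_range.1 hi)]
    simp

theorem chainCoeff_congr {κ κ' : ℕ → ℕ} {r : ℕ} (h : ∀ j < r, κ j = κ' j) (k : ℕ) :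
    chainCoeff κ r k = chainCoeff κ' r k := by
  induction r generalizing k with
  | zero => rfl
  | succ r ih =>
    rw [chainCoeff, chainCoeff, h r (by omega)]
    simp only [ih fun j hj => h j (by omega)]

/-- The exponent sequence with a `2` at position `i` and `1` elsewhere. -/
def oneTwo (i : ℕ) (j : ℕ) : ℕ := if j = i then 2 else 1

/-- Since the weight exceeds the depth by one, exactly one exponent is 2: the excesses κ_j - 1 sum
to 1. -/
theorem sum_indices (r : ℕ) (F : (Fin r → ℕ) → ℝ) :
    ∑ κ ∈ indices (r + 1) r, F κ = ∑ i ∈ Finset.range r, F (fun j => oneTwo i j) := by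
  rw [← Fin.sum_univ_eq_sum_range (fun i => F fun j => oneTwo i j)]
  symm
  refine Finset.sum_bij (fun i _ => fun j : Fin r => oneTwo i j) ?_ ?_ ?_ ?_
  · intro i _
    simp only [indices, Finset.mem_filter, Finset.Nat.mem_antidiagonalTuple]
    constructor
    · have : ∀ j : Fin r, oneTwo i j = 1 + if j = i then 1 else 0 := by
        intro j
        simp only [oneTwo, Fin.val_inj]
        split_ifs <;> rfl
      simp [this, Finset.sum_add_distrib]
    · intro j
      unfold oneTwo
      split_ifs <;> omega
  · intro i _ i' _ h
    have := congrFun h i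
    simp only [oneTwo, if_true, Fin.val_inj] at this
    by_contra hne
    simp [hne] at this
  · intro κ hκ
    simp only [indices, Finset.mem_filter, Finset.Nat.mem_antidiagonalTuple] at hκ
    obtain ⟨h1, h2⟩ := hκ
    have h3 : ∑ j, (κ j - 1) = 1 := by
      have : ∑ j, (κ j - 1) + ∑ _j : Fin r, 1 = r + 1 := by
        rw [← Finset.sum_add_distrib, ← h1]
        exact Finset.sum_congr rfl fun j _ => Nat.sub_add_cancel (h2 j)
      simp at this
      omega
    obtain ⟨i, hi⟩ : ∃ i, κ i - 1 ≠ 0 := by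
      by_contra! h
      simp [h] at h3
    rw [Fintype.sum_eq_add_sum_compl i] at h3
    have h4 : ∑ j ∈ {i}ᶜ, (κ j - 1) = 0 := by omega
    refine ⟨i, Finset.mem_univ _, funext fun j => ?_⟩
    simp only [oneTwo, Fin.val_inj]
    split_ifs with h
    · subst h; omega
    · have := Finset.sum_eq_zero_iff.1 h4 j (by simpa using h)
      have := h2 j
      omega
  · intro i _
    rfl

/-- The coefficients of the sum of the series over all positions of the exponent `2`. -/
noncomputable def weightCoeff (r k : ℕ) : ℝ :=
  ∑ i ∈ Finset.range r, chainCoeff (oneTwo i) r k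

theorem chainCoeff_one_succ (r k : ℕ) :
    chainCoeff 1 (r + 1) k =
      2 * (∑ i ∈ Finset.range (k + 1), chainCoeff 1 r i) / ((r : ℝ) + 1 + 2 * k) := by
  simp [chainCoeff]

/-- Either the exponent 2 sits among the first r positions, or it is last and costs the all-ones
coefficient one further division. -/
theorem weightCoeff_succ (r k : ℕ) :
    weightCoeff (r + 1) k =
      (2 * (∑ i ∈ Finset.range (k + 1), weightCoeff r i) + chainCoeff 1 (r + 1) k) /
        ((r : ℝ) + 1 + 2 * k) := by
  have h1 : ∀ i ∈ Finset.range r, chainCoeff (oneTwo i) (r + 1) k =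
      2 * (∑ l ∈ Finset.range (k + 1), chainCoeff (oneTwo i) r l) / ((r : ℝ) + 1 + 2 * k) := by
    intro i hi
    have : r ≠ i := by have := Finset.mem_range.1 hi; omega
    rw [chainCoeff, oneTwo, if_neg this, pow_one]
  have h2 : ∀ l, chainCoeff (oneTwo r) r l = chainCoeff 1 r l := fun l =>
    chainCoeff_congr (fun j hj => by simp [oneTwo, hj.ne]) l
  rw [weightCoeff, Finset.sum_range_succ, Finset.sum_congr rfl h1, ← Finset.sum_div,
    ← Finset.mul_sum, Finset.sum_comm, chainCoeff, chainCoeff_one_succ]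
  simp only [h2, oneTwo, if_true, weightCoeff]
  have : (r : ℝ) + 1 + 2 * k ≠ 0 := by positivity
  field_simp

end Chains

/-! ### Conditional convergence of the alternating series -/

section Convergence

theorem chainCoeff_nonneg (κ : ℕ → ℕ) (r k : ℕ) : 0 ≤ chainCoeff κ r k := by
  induction r generalizing k with
  | zero => rw [chainCoeff]; split_ifs <;> norm_num
  | succ r ih =>
    rw [chainCoeff]
    have := Finset.sum_nonneg fun i (_ : i ∈ Finset.range (k + 1)) => ih i
    positivity

theorem sum_inv_sqrt_le (n : ℕ) :
    ∑ i ∈ Finset.range n, 1 / √((i : ℝ) + 1) ≤ 2 * √(n : ℝ) := by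
  induction n with
  | zero => simp
  | succ n ih =>
    rw [Finset.sum_range_succ]
    push_cast
    have hx := Real.sq_sqrt (Nat.cast_nonneg n : (0 : ℝ) ≤ n)
    have hy := Real.sq_sqrt (by positivity : (0 : ℝ) ≤ (n : ℝ) + 1)
    have hpos : 0 < √((n : ℝ) + 1) := by positivity
    have : 1 / √((n : ℝ) + 1) ≤ 2 * √((n : ℝ) + 1) - 2 * √(n : ℝ) := by
      rw [div_le_iff₀ hpos]
      nlinarith [sq_nonneg (√((n : ℝ) + 1) - √(n : ℝ))]
    linarith

theorem sum_le_of_le_inv_sqrt {c : ℕ → ℝ} {C : ℝ} (h : ∀ k, c k ≤ C / √((k : ℝ) + 1))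
    (hC : 0 ≤ C) (k : ℕ) :
    ∑ i ∈ Finset.range (k + 1), c i ≤ 2 * C * √((k : ℝ) + 1) := by
  have h1 := sum_inv_sqrt_le (k + 1)
  push_cast at h1
  calc ∑ i ∈ Finset.range (k + 1), c i
      ≤ ∑ i ∈ Finset.range (k + 1), C * (1 / √((i : ℝ) + 1)) :=
        Finset.sum_le_sum fun i _ => (h i).trans_eq (by ring)
    _ = C * ∑ i ∈ Finset.range (k + 1), 1 / √((i : ℝ) + 1) := by rw [Finset.mul_sum]
    _ ≤ C * (2 * √((k : ℝ) + 1)) := by gcongr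
    _ = 2 * C * √((k : ℝ) + 1) := by ring

/-- The decay 1/√(k+1) reproduces itself: partial sums grow like 2√(k+1), and division by at least k
+ 1 restores it, at the price of a factor 4 per depth. -/
theorem chainCoeff_le {κ : ℕ → ℕ} (hκ : ∀ j, 1 ≤ κ j) (r k : ℕ) :
    chainCoeff κ r k ≤ 4 ^ r / √((k : ℝ) + 1) := by
  induction r generalizing k with
  | zero =>
    rw [chainCoeff]
    split_ifs with h
    · simp [h]
    · positivity
  | succ r ih =>
    have hM : (k : ℝ) + 1 ≤ ((r : ℝ) + 1 + 2 * k) ^ κ r := by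
      have h1 : (k : ℝ) + 1 ≤ (r : ℝ) + 1 + 2 * k := by
        have : (0 : ℝ) ≤ k := by positivity
        have : (0 : ℝ) ≤ r := by positivity
        linarith
      exact h1.trans (le_self_pow₀ (le_trans (by linarith [(Nat.cast_nonneg k : (0 : ℝ) ≤ k)]) h1)
        (by have := hκ r; omega))
    have hs := sum_le_of_le_inv_sqrt ih (by positivity) k
    have h0 : 0 ≤ ∑ i ∈ Finset.range (k + 1), chainCoeff κ r i :=
      Finset.sum_nonneg fun i _ => chainCoeff_nonneg κ r i
    have hy := Real.mul_self_sqrt (by positivity : (0 : ℝ) ≤ (k : ℝ) + 1)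
    have hpos : 0 < √((k : ℝ) + 1) := by positivity
    rw [chainCoeff]
    calc 2 * (∑ i ∈ Finset.range (k + 1), chainCoeff κ r i) / ((r : ℝ) + 1 + 2 * k) ^ κ r
        ≤ 2 * (2 * 4 ^ r * √((k : ℝ) + 1)) / (k + 1) := by gcongr
      _ = 4 ^ (r + 1) / √((k : ℝ) + 1) := by
        rw [div_eq_div_iff (by positivity) hpos.ne']
        linear_combination 4 * 4 ^ r * hy

/-- Summation by parts: up to boundary terms, twice the alternating sum is the absolutely convergent
alternating sum of the differences. No monotonicity of `c` is needed. -/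
theorem tendsto_alternating_of_summable_diff {c : ℕ → ℝ} (h0 : Tendsto c atTop (𝓝 0))
    (hs : Summable fun k => |c (k + 1) - c k|) :
    ∃ l, Tendsto (fun K => ∑ k ∈ Finset.range K, (-1) ^ k * c k) atTop (𝓝 l) := by
  have h1 : ∀ K, ∑ k ∈ Finset.range K, (-1) ^ k * c k =
      (∑ k ∈ Finset.range K, (-1) ^ k * (c k - c (k + 1)) + c 0 - (-1) ^ K * c K) / 2 := by
    intro K
    induction K with
    | zero => simp
    | succ K ih =>
      rw [Finset.sum_range_succ, ih, Finset.sum_range_succ]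
      ring
  have h2 : Summable fun k => (-1) ^ k * (c k - c (k + 1)) := by
    refine Summable.of_norm (hs.congr fun k => ?_)
    rw [norm_mul, norm_pow, norm_neg, norm_one, one_pow, one_mul, Real.norm_eq_abs, abs_sub_comm]
  have h3 : Tendsto (fun K => (-1) ^ K * c K) atTop (𝓝 0) := by
    rw [tendsto_zero_iff_norm_tendsto_zero] at h0 ⊢
    refine h0.congr fun k => ?_
    rw [norm_mul, norm_pow, norm_neg, norm_one, one_pow, one_mul]
  exact ⟨_, (((h2.hasSum.tendsto_sum_nat.add_const (c 0)).sub h3).div_const 2).congr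
    fun K => (h1 K).symm⟩

theorem tendsto_inv_sqrt_atTop (C : ℝ) :
    Tendsto (fun k : ℕ => C / √((k : ℝ) + 1)) atTop (𝓝 0) := by
  refine Tendsto.div_atTop tendsto_const_nhds ?_
  exact Real.tendsto_sqrt_atTop.comp
    (tendsto_atTop_add_const_right _ 1 tendsto_natCast_atTop_atTop)

theorem summable_inv_mul_sqrt : Summable fun k : ℕ => 1 / (((k : ℝ) + 1) * √((k : ℝ) + 1)) := by
  have h := (summable_nat_add_iff 1).2
    (Real.summable_one_div_nat_rpow.2 (by norm_num : (1 : ℝ) < 3 / 2))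
  refine h.congr fun k => ?_
  push_cast
  have hk : (0 : ℝ) < (k : ℝ) + 1 := by positivity
  rw [show (3 / 2 : ℝ) = 1 + 1 / 2 by norm_num, Real.rpow_add hk, Real.rpow_one,
    Real.sqrt_eq_rpow]

theorem inv_pow_sub_inv_pow_le {x M : ℝ} {e : ℕ} (hx : 1 ≤ x) (hM : x ≤ M) (he : 1 ≤ e) :
    1 / M ^ e - 1 / (M + 2) ^ e ≤ 2 / x ^ 2 := by
  have hM0 : 0 < M := by linarith
  rcases Nat.lt_or_ge e 2 with h | h
  · obtain rfl : e = 1 := by omega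
    rw [pow_one, pow_one, div_sub_div _ _ hM0.ne' (by positivity)]
    rw [div_le_div_iff₀ (by positivity) (by positivity)]
    nlinarith
  · have h1 : x ^ 2 ≤ M ^ e := (pow_le_pow_left₀ (by linarith) hM 2).trans
      (pow_le_pow_right₀ (hx.trans hM) h)
    have h2 : 1 / M ^ e ≤ 1 / x ^ 2 := one_div_le_one_div_of_le (by positivity) h1
    have h3 : 0 ≤ 1 / (M + 2) ^ e := by positivity
    have h4 : 1 / x ^ 2 ≤ 2 / x ^ 2 := by gcongr; norm_num
    linarith

theorem abs_chainCoeff_succ_sub_le {κ : ℕ → ℕ} (hκ : ∀ j, 1 ≤ κ j) (r k : ℕ) :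
    |chainCoeff κ (r + 1) (k + 1) - chainCoeff κ (r + 1) k| ≤
      10 * 4 ^ r * (1 / (((k : ℝ) + 1) * √((k : ℝ) + 1))) := by
  set S := ∑ i ∈ Finset.range (k + 1), chainCoeff κ r i with hS
  set M : ℝ := (r : ℝ) + 1 + 2 * k with hM
  set x : ℝ := (k : ℝ) + 1 with hx
  have hx1 : 1 ≤ x := by simp [hx]
  have hxM : x ≤ M := by
    have : (0 : ℝ) ≤ k := by positivity
    have : (0 : ℝ) ≤ r := by positivity
    rw [hx, hM]; linarith
  have hM0 : 0 < M := by linarith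
  -- The change splits into the new summand, bounded by 2·4^r/(x√x), and the change of denominator,
  -- bounded by 8·4^r/(x√x); hence the constant 10.
  have e1 : chainCoeff κ (r + 1) (k + 1) - chainCoeff κ (r + 1) k =
      2 * chainCoeff κ r (k + 1) / (M + 2) ^ κ r -
        2 * S * (1 / M ^ κ r - 1 / (M + 2) ^ κ r) := by
    rw [chainCoeff, chainCoeff, Finset.sum_range_succ, ← hS, ← hM,
      show (r : ℝ) + 1 + 2 * ((k + 1 : ℕ) : ℝ) = M + 2 by rw [hM]; push_cast; ring]
    ring
  have hS0 : 0 ≤ S := Finset.sum_nonneg fun i _ => chainCoeff_nonneg κ r i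
  have hS1 : S ≤ 2 * 4 ^ r * √x := sum_le_of_le_inv_sqrt (chainCoeff_le hκ r) (by positivity) k
  have ha0 := chainCoeff_nonneg κ r (k + 1)
  have hpos : 0 < √x := by positivity
  have hsq := Real.mul_self_sqrt (by positivity : 0 ≤ x)
  have ha1 : chainCoeff κ r (k + 1) ≤ 4 ^ r / √x := by
    refine (chainCoeff_le hκ r (k + 1)).trans ?_
    gcongr
    rw [hx]; push_cast; linarith
  have hd0 : 0 ≤ 1 / M ^ κ r - 1 / (M + 2) ^ κ r := by
    rw [sub_nonneg]
    gcongr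
    linarith
  have hd1 := inv_pow_sub_inv_pow_le hx1 hxM (hκ r)
  have hMe : x ≤ (M + 2) ^ κ r :=
    (by linarith : x ≤ M + 2).trans (le_self_pow₀ (by linarith) (by have := hκ r; omega))
  have b1 : 2 * chainCoeff κ r (k + 1) / (M + 2) ^ κ r ≤ 2 * (4 ^ r / √x) / x := by gcongr
  have b2 : 2 * S * (1 / M ^ κ r - 1 / (M + 2) ^ κ r) ≤
      2 * (2 * 4 ^ r * √x) * (2 / x ^ 2) := by gcongr
  have b3 : 0 ≤ 2 * chainCoeff κ r (k + 1) / (M + 2) ^ κ r := by positivity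
  have b4 : 0 ≤ 2 * S * (1 / M ^ κ r - 1 / (M + 2) ^ κ r) := by positivity
  have e2 : 2 * (4 ^ r / √x) / x + 2 * (2 * 4 ^ r * √x) * (2 / x ^ 2) =
      10 * 4 ^ r * (1 / (x * √x)) := by
    field_simp
    linear_combination 8 * hsq
  rw [e1, ← e2, abs_le]
  constructor <;> linarith [b1, b2, b3, b4]

theorem exists_tendsto_alternating_chainCoeff {κ : ℕ → ℕ} (hκ : ∀ j, 1 ≤ κ j) (r : ℕ) :
    ∃ l, Tendsto (fun K => ∑ k ∈ Finset.range K, (-1) ^ k * chainCoeff κ r k) atTop (𝓝 l) := by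
  cases r with
  | zero =>
    refine ⟨1, tendsto_const_nhds.congr' ?_⟩
    filter_upwards [eventually_gt_atTop 0] with K hK
    have : ∀ k, (-1 : ℝ) ^ k * chainCoeff κ 0 k = if k = 0 then 1 else 0 := by
      intro k
      rw [chainCoeff]
      split_ifs with h <;> simp [h]
    simp [this, hK]
  | succ r =>
    apply tendsto_alternating_of_summable_diff
    · exact squeeze_zero (chainCoeff_nonneg κ _) (chainCoeff_le hκ _) (tendsto_inv_sqrt_atTop _)
    · exact Summable.of_nonneg_of_le (fun _ => abs_nonneg _) (abs_chainCoeff_succ_sub_le hκ r)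
        (summable_inv_mul_sqrt.mul_left _)

theorem exists_tendsto_tBarPartial {r : ℕ} (κ : Fin (r + 1) → ℕ) (hκ : ∀ j, 1 ≤ κ j) :
    ∃ l, Tendsto (tBarPartial κ) atTop (𝓝 l) := by
  -- The padding value 1 keeps every exponent positive; positions beyond the depth are never read.
  let κ' : ℕ → ℕ := fun n => if h : n < r + 1 then κ ⟨n, h⟩ else 1
  have hκ' : ∀ j, 1 ≤ κ' j := by
    intro j
    simp only [κ']
    split_ifs
    · exact hκ _
    · exact le_rfl
  have e : κ = fun j : Fin (r + 1) => κ' j := by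
    funext j
    have : κ' j = κ ⟨j, j.2⟩ := dif_pos j.2
    exact this.symm
  obtain ⟨l, hl⟩ := exists_tendsto_alternating_chainCoeff hκ' (r + 1)
  refine ⟨(-1) ^ (r + 1) * l, ?_⟩
  rw [e, ← tendsto_add_atTop_iff_nat r]
  refine (hl.const_mul ((-1) ^ (r + 1))).congr fun K => ?_
  rw [add_comm K r, tBarPartial_eq_sum_chainCoeff, Finset.mul_sum]
  refine Finset.sum_congr rfl fun k _ => ?_
  rw [pow_add _ (r + 1) k]
  ring

theorem tendsto_tBarPartial {k r : ℕ} (hr : 1 ≤ r) {κ : Fin r → ℕ} (hκ : κ ∈ indices k r) :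
    Tendsto (tBarPartial κ) atTop (𝓝 (tBar κ)) := by
  obtain ⟨r, rfl⟩ : ∃ s, r = s + 1 := ⟨r - 1, by omega⟩
  exact tendsto_nhds_limUnder (exists_tendsto_tBarPartial κ (Finset.mem_filter.1 hκ).2)

theorem tendsto_alternating_weightCoeff {r : ℕ} (hr : 1 ≤ r) :
    Tendsto (fun K => ∑ k ∈ Finset.range K, (-1) ^ (r + k) * weightCoeff r k) atTop
      (𝓝 (W (r + 1) r)) := by
  have h : Tendsto (fun N => ∑ κ ∈ indices (r + 1) r, tBarPartial κ N) atTop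
      (𝓝 (W (r + 1) r)) := tendsto_finsetSum _ fun κ hκ => tendsto_tBarPartial hr hκ
  obtain ⟨r, rfl⟩ : ∃ s, r = s + 1 := ⟨r - 1, by omega⟩
  refine ((tendsto_add_atTop_iff_nat r).2 h).congr fun K => ?_
  rw [sum_indices (r + 1) fun κ => tBarPartial κ (K + r), add_comm K r]
  simp only [tBarPartial_eq_sum_chainCoeff]
  rw [Finset.sum_comm]
  simp only [weightCoeff, Finset.mul_sum]

end Convergence

/-! ### Differential equations for the generating series -/

section AlternatingSeries

/-- The power series `∑ (-1)^(r+k) c_k t^(r+2k)`. -/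
noncomputable def altSeries (c : ℕ → ℝ) (r : ℕ) (t : ℝ) : ℝ :=
  ∑' k, (-1) ^ (r + k) * c k * t ^ (r + 2 * k)

theorem abs_term_le {c : ℕ → ℝ} {C ρ t : ℝ} (hc : ∀ k, |c k| ≤ C * (k + 1)) (ht : |t| ≤ ρ)
    (hρ : ρ < 1) (m r k : ℕ) :
    |(-1) ^ (m + k) * c k * t ^ (r + 2 * k)| ≤ C * (((k : ℝ) + 1) * ρ ^ k) := by
  have hρ0 : 0 ≤ ρ := (abs_nonneg t).trans ht
  rw [abs_mul, abs_mul, abs_pow, abs_neg, abs_one, one_pow, one_mul, abs_pow, ← mul_assoc]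
  have h1 : |t| ^ (r + 2 * k) ≤ ρ ^ k :=
    (pow_le_pow_left₀ (abs_nonneg t) ht _).trans (pow_le_pow_of_le_one hρ0 hρ.le (by omega))
  exact mul_le_mul (hc k) h1 (by positivity) ((abs_nonneg _).trans (hc k))

theorem summable_bound {C ρ : ℝ} (hρ0 : 0 ≤ ρ) (hρ : ρ < 1) :
    Summable fun k : ℕ => C * (((k : ℝ) + 1) * ρ ^ k) := by
  refine Summable.mul_left _ ?_
  have h1 := summable_pow_mul_geometric_of_norm_lt_one 1 (r := ρ)
    (by rwa [Real.norm_of_nonneg hρ0])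
  have h2 := summable_geometric_of_lt_one hρ0 hρ
  exact (h1.add h2).congr fun k => by rw [pow_one]; ring

theorem summable_term {c : ℕ → ℝ} {C t : ℝ} (hc : ∀ k, |c k| ≤ C * (k + 1)) (ht : |t| < 1)
    (m r : ℕ) : Summable fun k => (-1) ^ (m + k) * c k * t ^ (r + 2 * k) :=
  Summable.of_norm_bounded (summable_bound (abs_nonneg t) ht)
    fun k => abs_term_le hc le_rfl ht m r k

theorem abs_natLinear_mul_le {c : ℕ → ℝ} {C : ℝ} (hc : ∀ k, |c k| ≤ C) (r k : ℕ) :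
    |((r : ℝ) + 1 + 2 * k) * c k| ≤ (((r : ℝ) + 2) * C) * (k + 1) := by
  have hC := (abs_nonneg _).trans (hc 0)
  rw [abs_mul, abs_of_nonneg (by positivity)]
  have hk : (0 : ℝ) ≤ k := by positivity
  have hr : (0 : ℝ) ≤ r := by positivity
  calc ((r : ℝ) + 1 + 2 * k) * |c k| ≤ (((r : ℝ) + 2) * (k + 1)) * C := by
        refine mul_le_mul ?_ (hc k) (abs_nonneg _) (by positivity)
        nlinarith
    _ = _ := by ring

theorem le_mul_succ {c : ℕ → ℝ} {C : ℝ} (hc : ∀ k, |c k| ≤ C) (k : ℕ) : |c k| ≤ C * (k + 1) := by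
  have hC := (abs_nonneg _).trans (hc 0)
  have hk : (0 : ℝ) ≤ k := by positivity
  nlinarith [hc k]

theorem abs_sum_range_succ_le {c : ℕ → ℝ} {C : ℝ} (hc : ∀ k, |c k| ≤ C) (k : ℕ) :
    |∑ i ∈ Finset.range (k + 1), c i| ≤ C * (k + 1) := by
  refine (Finset.abs_sum_le_sum_abs _ _).trans ((Finset.sum_le_sum fun i _ => hc i).trans_eq ?_)
  simp [mul_comm]

theorem hasDerivAt_altSeries {c : ℕ → ℝ} {C t : ℝ} (hc : ∀ k, |c k| ≤ C) (ht : |t| < 1) (r : ℕ) :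
    HasDerivAt (altSeries c (r + 1))
      (∑' k : ℕ, (-1) ^ (r + 1 + k) * (((r : ℝ) + 1 + 2 * k) * c k) * t ^ (r + 2 * k)) t := by
  obtain ⟨ρ, h1, h2⟩ := exists_between ht
  have hρ0 : 0 ≤ ρ := (abs_nonneg t).trans h1.le
  refine hasDerivAt_tsum_of_isPreconnected
    (g := fun (k : ℕ) (y : ℝ) => (-1) ^ (r + 1 + k) * c k * y ^ (r + 1 + 2 * k))
    (g' := fun (k : ℕ) (y : ℝ) =>
      (-1) ^ (r + 1 + k) * (((r : ℝ) + 1 + 2 * k) * c k) * y ^ (r + 2 * k))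
    (t := Set.Ioo (-ρ) ρ) (y₀ := t)
    (summable_bound (C := ((r : ℝ) + 2) * C) hρ0 h2) isOpen_Ioo isPreconnected_Ioo ?_ ?_
    (abs_lt.1 h1) (summable_term (le_mul_succ hc) ht _ _) (abs_lt.1 h1)
  · intro k y _
    have := (hasDerivAt_pow (r + 1 + 2 * k) y).const_mul ((-1) ^ (r + 1 + k) * c k)
    refine this.congr_deriv ?_
    rw [show r + 1 + 2 * k - 1 = r + 2 * k by omega]
    push_cast
    ring
  · intro k y hy
    exact abs_term_le (abs_natLinear_mul_le hc r) (abs_lt.2 hy).le h2 _ _ _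

/-- Multiplying by 1 + t² differences consecutive partial sums, since the signs alternate with t²;
the shifted sign exponent r + 1 + k gives the minus. -/
theorem tsum_partialSums {b : ℕ → ℝ} {C t : ℝ} (hb : ∀ k, |b k| ≤ C) (ht : |t| < 1) (r : ℕ) :
    (1 + t ^ 2) * ∑' k : ℕ, (-1) ^ (r + 1 + k) * (∑ i ∈ Finset.range (k + 1), b i) *
      t ^ (r + 2 * k) = -altSeries b r t := by
  have hS := summable_term (abs_sum_range_succ_le hb) ht (r + 1) r
  have hS1 := (summable_nat_add_iff 1).2 hS
  have hB := summable_term (le_mul_succ hb) ht r r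
  rw [altSeries, add_mul, one_mul, ← tsum_mul_left]
  conv_lhs => rw [hS.tsum_eq_zero_add]
  rw [add_assoc, ← hS1.tsum_add (hS.mul_left _), hB.tsum_eq_zero_add, neg_add, ← tsum_neg]
  congr 1
  · simp
    ring
  · refine tsum_congr fun k => ?_
    rw [Finset.sum_range_succ _ (k + 1)]
    ring

/-- Abel's limit theorem in the variable t², with the factor t^r tending to 1. -/
theorem tendsto_altSeries {c : ℕ → ℝ} {r : ℕ} {l : ℝ}
    (h : Tendsto (fun K => ∑ k ∈ Finset.range K, (-1) ^ (r + k) * c k) atTop (𝓝 l)) :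
    Tendsto (altSeries c r) (𝓝[<] 1) (𝓝 l) := by
  have h1 := Real.tendsto_tsum_powerSeries_nhdsWithin_lt h
  have h2 : Tendsto (fun t : ℝ => t ^ 2) (𝓝[<] 1) (𝓝[<] 1) := by
    refine tendsto_nhdsWithin_iff.2 ⟨?_, ?_⟩
    · have : Tendsto (fun t : ℝ => t ^ 2) (𝓝 1) (𝓝 (1 ^ 2)) := (continuous_pow 2).tendsto 1
      rw [one_pow] at this
      exact this.mono_left nhdsWithin_le_nhds
    · filter_upwards [Ioo_mem_nhdsLT (show (0 : ℝ) < 1 by norm_num)] with t ht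
      exact pow_lt_one₀ ht.1.le ht.2 (by norm_num)
  have h3 : Tendsto (fun t : ℝ => t ^ r) (𝓝[<] 1) (𝓝 1) := by
    have : Tendsto (fun t : ℝ => t ^ r) (𝓝 1) (𝓝 (1 ^ r)) := (continuous_pow r).tendsto 1
    rw [one_pow] at this
    exact this.mono_left nhdsWithin_le_nhds
  have h4 := h3.mul (h1.comp h2)
  rw [one_mul] at h4
  refine h4.congr fun t => ?_
  rw [altSeries, Function.comp_apply, ← tsum_mul_left]
  refine tsum_congr fun k => ?_
  rw [← pow_mul, pow_add]
  ring

theorem altSeries_succ_zero (c : ℕ → ℝ) (r : ℕ) : altSeries c (r + 1) 0 = 0 := by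
  simp [altSeries, add_right_comm]

theorem abs_chainCoeff_le {κ : ℕ → ℕ} (hκ : ∀ j, 1 ≤ κ j) (r k : ℕ) :
    |chainCoeff κ r k| ≤ 4 ^ r := by
  rw [abs_of_nonneg (chainCoeff_nonneg κ r k)]
  refine (chainCoeff_le hκ r k).trans (div_le_self (by positivity) ?_)
  rw [Real.one_le_sqrt]
  linarith [(Nat.cast_nonneg k : (0 : ℝ) ≤ k)]

theorem abs_weightCoeff_le (r k : ℕ) : |weightCoeff r k| ≤ r * 4 ^ r := by
  refine (Finset.abs_sum_le_sum_abs _ _).trans ((Finset.sum_le_sum fun i _ =>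
    abs_chainCoeff_le (fun j => ?_) r k).trans_eq ?_)
  · unfold oneTwo; split_ifs <;> omega
  · simp

theorem hasDerivAt_altSeries_chainCoeff {t : ℝ} (ht : |t| < 1) (r : ℕ) :
    HasDerivAt (altSeries (chainCoeff 1 (r + 1)) (r + 1))
      (-2 * altSeries (chainCoeff 1 r) r t / (1 + t ^ 2)) t := by
  have hb : ∀ r k, |chainCoeff 1 r k| ≤ 4 ^ r := abs_chainCoeff_le fun _ => le_rfl
  convert hasDerivAt_altSeries (hb (r + 1)) ht r using 1
  have h := tsum_partialSums (hb r) ht r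
  rw [div_eq_iff (by positivity), neg_mul, ← mul_neg, ← h, mul_left_comm, ← tsum_mul_left, mul_comm]
  congr 1
  refine tsum_congr fun k => ?_
  rw [chainCoeff_one_succ]
  have : (r : ℝ) + 1 + 2 * k ≠ 0 := by positivity
  field_simp

theorem hasDerivAt_altSeries_weightCoeff {t : ℝ} (ht : |t| < 1) (ht0 : t ≠ 0) (r : ℕ) :
    HasDerivAt (altSeries (weightCoeff (r + 1)) (r + 1))
      (-2 * altSeries (weightCoeff r) r t / (1 + t ^ 2) +
        altSeries (chainCoeff 1 (r + 1)) (r + 1) t / t) t := by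
  have hb : ∀ r k, |chainCoeff 1 r k| ≤ 4 ^ r := abs_chainCoeff_le fun _ => le_rfl
  convert hasDerivAt_altSeries (abs_weightCoeff_le (r + 1)) ht r using 1
  have h := tsum_partialSums (abs_weightCoeff_le r) ht r
  have e1 : -2 * altSeries (weightCoeff r) r t / (1 + t ^ 2) =
      2 * ∑' k : ℕ, (-1) ^ (r + 1 + k) * (∑ i ∈ Finset.range (k + 1), weightCoeff r i) *
      t ^ (r + 2 * k) := by
    rw [div_eq_iff (by positivity), neg_mul, ← mul_neg, ← h]
    ring
  have e2 : altSeries (chainCoeff 1 (r + 1)) (r + 1) t / t =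
      ∑' k : ℕ, (-1) ^ (r + 1 + k) * chainCoeff 1 (r + 1) k * t ^ (r + 2 * k) := by
    rw [altSeries, ← tsum_div_const]
    refine tsum_congr fun k => ?_
    rw [show r + 1 + 2 * k = r + 2 * k + 1 by ring, pow_succ t]
    field_simp
  rw [e1, e2, ← tsum_mul_left, ← Summable.tsum_add]
  · refine tsum_congr fun k => ?_
    rw [weightCoeff_succ]
    have : (r : ℝ) + 1 + 2 * k ≠ 0 := by positivity
    field_simp
  · exact (summable_term (abs_sum_range_succ_le (abs_weightCoeff_le r)) ht (r + 1) r).mul_left _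
  · exact summable_term (le_mul_succ (hb (r + 1))) ht (r + 1) r

/-- By induction both sides have the same derivative on (-1, 1), and both vanish at 0 when the depth
is positive. -/
theorem altSeries_chainCoeff {t : ℝ} (ht : |t| < 1) (r : ℕ) :
    altSeries (chainCoeff 1 r) r t = (-2 * Real.arctan t) ^ r / r.factorial := by
  induction r generalizing t with
  | zero =>
    rw [altSeries, tsum_eq_single 0]
    · simp [chainCoeff]
    · intro k hk
      simp [chainCoeff, hk]
  | succ r ih =>
    have hd : ∀ y : ℝ, HasDerivAt
        (fun y => (-2 * Real.arctan y) ^ (r + 1) / ((r + 1).factorial : ℝ))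
        (-2 * ((-2 * Real.arctan y) ^ r / r.factorial) / (1 + y ^ 2)) y := by
      intro y
      refine HasDerivAt.congr_deriv ((((Real.hasDerivAt_arctan y).const_mul (-2)).pow (r + 1)).div_const
        ((r + 1).factorial : ℝ)) ?_
      rw [Nat.factorial_succ]
      push_cast
      have : (r : ℝ) + 1 ≠ 0 := by positivity
      field_simp
    have hmem : ∀ {y : ℝ}, y ∈ Set.Ioo (-1 : ℝ) 1 → |y| < 1 := fun h => abs_lt.2 h
    refine isOpen_Ioo.eqOn_of_deriv_eq (s := Set.Ioo (-1 : ℝ) 1)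
      (f := altSeries (chainCoeff 1 (r + 1)) (r + 1))
      (g := fun y => (-2 * Real.arctan y) ^ (r + 1) / ((r + 1).factorial : ℝ)) isPreconnected_Ioo
      (fun y hy => (hasDerivAt_altSeries_chainCoeff (hmem hy) r).differentiableAt.differentiableWithinAt)
      (fun y hy => (hd y).differentiableAt.differentiableWithinAt) ?_
      (x := 0) (by norm_num) ?_ (abs_lt.1 ht)
    · intro y hy
      rw [(hasDerivAt_altSeries_chainCoeff (hmem hy) r).deriv, (hd y).deriv, ih (hmem hy)]
    · rw [altSeries_succ_zero]
      simp

end AlternatingSeries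

/-! ### The substitution t = tan(θ/2) -/

section HalfAngle

theorem tan_half_mem {θ : ℝ} (hθ : θ ∈ Set.Ioo 0 (Real.pi / 2)) :
    Real.tan (θ / 2) ∈ Set.Ioo (0 : ℝ) 1 := by
  obtain ⟨h1, h2⟩ := hθ
  refine ⟨Real.tan_pos_of_pos_of_lt_pi_div_two (by linarith) (by linarith), ?_⟩
  rw [← Real.tan_pi_div_four]
  exact Real.tan_lt_tan_of_lt_of_lt_pi_div_two (by linarith) (by linarith) (by linarith)

/-- Here 2 dt/(1+t²) = dθ, dt/t = dθ/sin θ and -2 arctan t = -θ. -/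
theorem hasDerivAt_weightSeries_tan_half {θ : ℝ} (hθ : θ ∈ Set.Ioo 0 (Real.pi / 2)) (r : ℕ) :
    HasDerivAt (fun x => altSeries (weightCoeff (r + 1)) (r + 1) (Real.tan (x / 2)))
      (-altSeries (weightCoeff r) r (Real.tan (θ / 2)) +
        (-θ) ^ (r + 1) / (r + 1).factorial / Real.sin θ) θ := by
  have ht := tan_half_mem hθ
  have habs : |Real.tan (θ / 2)| < 1 := by rw [abs_of_pos ht.1]; exact ht.2
  obtain ⟨h1, h2⟩ := hθ
  have hcos : Real.cos (θ / 2) ≠ 0 :=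
    (Real.cos_pos_of_mem_Ioo ⟨by linarith, by linarith⟩).ne'
  have hsin : Real.sin (θ / 2) ≠ 0 :=
    (Real.sin_pos_of_pos_of_lt_pi (by linarith) (by linarith)).ne'
  have hd : HasDerivAt (fun x : ℝ => Real.tan (x / 2)) (1 / Real.cos (θ / 2) ^ 2 * (1 / 2)) θ :=
    HasDerivAt.comp (h₂ := Real.tan) θ (Real.hasDerivAt_tan hcos) ((hasDerivAt_id θ).div_const 2)
  refine HasDerivAt.congr_deriv (HasDerivAt.comp (h := fun x : ℝ => Real.tan (x / 2)) θ
    (hasDerivAt_altSeries_weightCoeff habs ht.1.ne' r) hd) ?_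
  have e : 1 + Real.tan (θ / 2) ^ 2 = 1 / Real.cos (θ / 2) ^ 2 := by
    rw [Real.tan_eq_sin_div_cos]
    field_simp
    linarith [Real.sin_sq_add_cos_sq (θ / 2)]
  have es : Real.sin θ = 2 * Real.sin (θ / 2) * Real.cos (θ / 2) := by
    rw [← Real.sin_two_mul]; ring_nf
  rw [altSeries_chainCoeff habs, Real.arctan_tan (by linarith) (by linarith), e, es]
  rw [show -2 * (θ / 2) = -θ by ring]
  generalize altSeries (weightCoeff r) r (Real.tan (θ / 2)) = D
  rw [Real.tan_eq_sin_div_cos]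
  field_simp

theorem sum_divided_powers (x y : ℝ) (n : ℕ) :
    ∑ r ∈ Finset.range (n + 1), x ^ r / r.factorial * (y ^ (n - r) / (n - r).factorial) =
      (x + y) ^ n / n.factorial := by
  rw [add_pow, Finset.sum_div]
  refine Finset.sum_congr rfl fun r hr => ?_
  rw [Nat.cast_choose ℝ (by simpa [Nat.lt_succ_iff] using hr)]
  have := Nat.cast_ne_zero (R := ℝ).2 n.factorial_ne_zero
  field_simp

theorem hasDerivAt_divided_power (a x : ℝ) (q : ℕ) :
    HasDerivAt (fun x : ℝ => (x - a) ^ (q + 1) / ((q + 1).factorial : ℝ))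
      ((x - a) ^ q / q.factorial) x := by
  refine HasDerivAt.congr_deriv
    ((((hasDerivAt_id x).sub_const a).pow (q + 1)).div_const ((q + 1).factorial : ℝ)) ?_
  rw [Nat.factorial_succ]
  push_cast
  have : (q : ℝ) + 1 ≠ 0 := by positivity
  simp
  field_simp

/-- A combination of the series of all lower depths whose derivative is elementary. -/
noncomputable def primitive (m : ℕ) (θ : ℝ) : ℝ :=
  ∑ r ∈ Finset.range (m + 1), altSeries (weightCoeff (r + 1)) (r + 1) (Real.tan (θ / 2)) *
    ((θ - Real.pi / 2) ^ (m - r) / (m - r).factorial)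

/-- Differentiating the divided power multiplying D_{r+1} cancels the term -D_{r+1} from the next
depth. The elementary terms left over form a binomial expansion of (-θ + (θ - π/2))^(m+1) lacking
its r = 0 term. -/
theorem hasDerivAt_primitive {θ : ℝ} (hθ : θ ∈ Set.Ioo 0 (Real.pi / 2)) (m : ℕ) :
    HasDerivAt (primitive m)
      (((-(Real.pi / 2)) ^ (m + 1) - (θ - Real.pi / 2) ^ (m + 1)) / (m + 1).factorial /
        Real.sin θ) θ := by
  set D : ℕ → ℝ := fun r => altSeries (weightCoeff r) r (Real.tan (θ / 2)) with hD
  set y := θ - Real.pi / 2 with hy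
  have hD0 : D 0 = 0 := by simp [hD, altSeries, weightCoeff]
  let c' : ℕ → ℝ := fun q => if q = 0 then 0 else y ^ (q - 1) / (q - 1).factorial
  have hc : ∀ q : ℕ, HasDerivAt (fun x : ℝ => (x - Real.pi / 2) ^ q / (q.factorial : ℝ)) (c' q) θ := by
    intro q
    cases q with
    | zero => simpa [c'] using hasDerivAt_const θ (1 : ℝ)
    | succ q => simpa [c'] using hasDerivAt_divided_power (Real.pi / 2) θ q
  have h := HasDerivAt.fun_sum (u := Finset.range (m + 1)) fun r _ =>
    (hasDerivAt_weightSeries_tan_half hθ r).mul (hc (m - r))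
  refine HasDerivAt.congr_deriv h ?_
  have e1 : ∑ r ∈ Finset.range (m + 1), D (r + 1) * c' (m - r) =
      ∑ r ∈ Finset.range (m + 1), D r * (y ^ (m - r) / (m - r).factorial) := by
    rw [Finset.sum_range_succ, Finset.sum_range_succ', hD0, Nat.sub_self]
    simp only [c', if_true, mul_zero, zero_mul, add_zero]
    refine Finset.sum_congr rfl fun r hr => ?_
    have := Finset.mem_range.1 hr
    rw [if_neg (by omega), Nat.sub_sub]
  have e2 := sum_divided_powers (-θ) y (m + 1)
  rw [Finset.sum_range_succ'] at e2
  simp only [Nat.add_sub_add_right, pow_zero, Nat.factorial_zero, Nat.cast_one, div_one, one_mul,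
    Nat.sub_zero] at e2
  rw [Finset.sum_add_distrib]
  change _ + ∑ r ∈ Finset.range (m + 1), D (r + 1) * c' (m - r) = _
  rw [e1, ← Finset.sum_add_distrib]
  have e3 : ∀ r ∈ Finset.range (m + 1),
      (-D r + (-θ) ^ (r + 1) / (r + 1).factorial / Real.sin θ) *
        (y ^ (m - r) / (m - r).factorial) + D r * (y ^ (m - r) / (m - r).factorial) =
      (-θ) ^ (r + 1) / (r + 1).factorial * (y ^ (m - r) / (m - r).factorial) / Real.sin θ := by
    intro r _
    ring
  refine (Finset.sum_congr rfl e3).trans ?_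
  rw [← Finset.sum_div, eq_sub_of_add_eq e2, ← sub_div,
    show -θ + y = -(Real.pi / 2) by rw [hy]; ring]

end HalfAngle

/-! ### The integral for W and its Fourier expansion -/

section Kernel

/-- The function `((π/2)^n - (π/2 - θ)^n) / (n! sin θ)`, extended continuously to `θ = 0`. -/
noncomputable def kernelFun (n : ℕ) (θ : ℝ) : ℝ :=
  (∑ i ∈ Finset.range n, (Real.pi / 2) ^ i * (Real.pi / 2 - θ) ^ (n - 1 - i)) / n.factorial /
    Real.sinc θ

theorem sinc_pos {θ : ℝ} (hθ : θ ∈ Set.Icc 0 (Real.pi / 2)) : 0 < Real.sinc θ := by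
  rcases hθ.1.eq_or_lt with rfl | h
  · simp
  · rw [Real.sinc_of_ne_zero h.ne']
    exact div_pos (Real.sin_pos_of_pos_of_lt_pi h (by linarith [hθ.2, Real.pi_pos])) h

theorem continuousOn_kernelFun (n : ℕ) : ContinuousOn (kernelFun n) (Set.Icc 0 (Real.pi / 2)) := by
  refine ContinuousOn.div (by fun_prop) Real.continuous_sinc.continuousOn fun θ hθ => (sinc_pos hθ).ne'

theorem kernelFun_mul_sin (n : ℕ) {θ : ℝ} (hθ : θ ∈ Set.Icc 0 (Real.pi / 2)) :
    kernelFun n θ * Real.sin θ =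
      ((Real.pi / 2) ^ n - (Real.pi / 2 - θ) ^ n) / n.factorial := by
  have hs : Real.sin θ = Real.sinc θ * θ := by
    rcases eq_or_ne θ 0 with rfl | h
    · simp
    · rw [Real.sinc_of_ne_zero h, div_mul_cancel₀ _ h]
  rw [kernelFun, hs, ← geom_sum₂_mul]
  have := (sinc_pos hθ).ne'
  field_simp
  ring

theorem intervalIntegrable_of_continuousOn_Icc {f : ℝ → ℝ} {b : ℝ} (hb : 0 ≤ b)
    (hf : ContinuousOn f (Set.Icc 0 b)) : IntervalIntegrable f MeasureTheory.volume 0 b :=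
  ContinuousOn.intervalIntegrable (by rwa [Set.uIcc_of_le hb])

/-- The Riemann–Lebesgue lemma for `g` cut off to (0, b]; frequency N/π, because the Fourier
character carries a factor 2π. -/
theorem tendsto_integral_mul_cos {g : ℝ → ℝ} {b : ℝ} (hb : 0 ≤ b)
    (hg : ContinuousOn g (Set.Icc 0 b)) :
    Tendsto (fun N : ℕ => ∫ θ in (0 : ℝ)..b, g θ * Real.cos (2 * N * θ)) atTop (𝓝 0) := by
  have hw : Tendsto (fun N : ℕ => (N : ℝ) / Real.pi) atTop (cocompact ℝ) :=
    (tendsto_natCast_atTop_atTop.atTop_div_const Real.pi_pos).mono_right atTop_le_cocompact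
  have h := (Complex.continuous_re.tendsto 0).comp
    ((Real.tendsto_integral_exp_smul_cocompact
      (Set.indicator (Set.Ioc 0 b) fun θ => (g θ : ℂ))).comp hw)
  rw [Complex.zero_re] at h
  refine h.congr fun N => ?_
  simp only [Function.comp_apply]
  have e1 : (fun v : ℝ => Real.fourierChar (-(v * ((N : ℝ) / Real.pi))) •
      Set.indicator (Set.Ioc 0 b) (fun θ => (g θ : ℂ)) v) =
      Set.indicator (Set.Ioc 0 b)
        (fun v => Real.fourierChar (-(v * ((N : ℝ) / Real.pi))) • (g v : ℂ)) := by
    funext v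
    by_cases hv : v ∈ Set.Ioc 0 b
    · simp [hv]
    · simp [hv]
  rw [e1, MeasureTheory.integral_indicator measurableSet_Ioc,
    ← intervalIntegral.integral_of_le hb, ← Complex.reCLM_apply,
    ← ContinuousLinearMap.intervalIntegral_comp_comm]
  · refine intervalIntegral.integral_congr fun v _ => ?_
    simp only [Complex.reCLM_apply, Circle.smul_def, Real.fourierChar_apply, smul_eq_mul]
    rw [Complex.re_mul_ofReal, Complex.exp_ofReal_mul_I_re,
      show 2 * Real.pi * -(v * ((N : ℝ) / Real.pi)) = -(2 * N * v) by
        field_simp, Real.cos_neg, mul_comm]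
  · refine ContinuousOn.intervalIntegrable ?_
    rw [Set.uIcc_of_le hb]
    simp only [Circle.smul_def, Real.fourierChar_apply, smul_eq_mul]
    exact ContinuousOn.mul (by fun_prop) (Complex.continuous_ofReal.comp_continuousOn hg)

theorem sin_mul_sum_sin_odd (θ : ℝ) (N : ℕ) :
    Real.sin θ * ∑ q ∈ Finset.range N, 2 * Real.sin ((2 * q + 1 : ℕ) * θ) =
      1 - Real.cos (2 * N * θ) := by
  induction N with
  | zero => simp
  | succ N ih =>
    rw [Finset.sum_range_succ, mul_add, ih]
    push_cast
    rw [show 2 * ((N : ℝ) + 1) * θ = (2 * N + 1) * θ + θ by ring,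
      show 2 * (N : ℝ) * θ = (2 * N + 1) * θ - θ by ring, Real.cos_add, Real.cos_sub]
    ring

theorem tendsto_tan_half :
    Tendsto (fun θ : ℝ => Real.tan (θ / 2)) (𝓝[<] (Real.pi / 2)) (𝓝[<] 1) := by
  refine tendsto_nhdsWithin_iff.2 ⟨?_, ?_⟩
  · have hc : ContinuousAt (fun θ : ℝ => Real.tan (θ / 2)) (Real.pi / 2) := by
      refine ContinuousAt.comp (g := Real.tan) ?_ (by fun_prop)
      refine Real.continuousAt_tan.2 ?_
      rw [show Real.pi / 2 / 2 = Real.pi / 4 by ring, Real.cos_pi_div_four]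
      positivity
    have h := hc.tendsto
    rw [show Real.pi / 2 / 2 = Real.pi / 4 by ring, Real.tan_pi_div_four] at h
    exact h.mono_left nhdsWithin_le_nhds
  · filter_upwards [Ioo_mem_nhdsLT (show (0 : ℝ) < Real.pi / 2 by positivity)] with θ hθ
    exact (tan_half_mem hθ).2

theorem tendsto_primitive_left (m : ℕ) : Tendsto (primitive m) (𝓝[>] 0) (𝓝 0) := by
  have h : Tendsto (primitive m) (𝓝[>] 0) (𝓝 (∑ r ∈ Finset.range (m + 1),
      0 * (((0 : ℝ) - Real.pi / 2) ^ (m - r) / (m - r).factorial))) := by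
    refine tendsto_finsetSum _ fun r _ => Tendsto.mul ?_ ?_
    · have h1 : ContinuousAt (altSeries (weightCoeff (r + 1)) (r + 1)) (Real.tan (0 / 2)) := by
        rw [zero_div, Real.tan_zero]
        exact (hasDerivAt_altSeries (abs_weightCoeff_le (r + 1)) (by simp) r).continuousAt
      have h2 : ContinuousAt (fun θ : ℝ => Real.tan (θ / 2)) 0 := by
        refine ContinuousAt.comp (g := Real.tan) ?_ (by fun_prop)
        exact Real.continuousAt_tan.2 (by simp)
      have h3 := (ContinuousAt.comp (f := fun θ : ℝ => Real.tan (θ / 2)) h1 h2).tendsto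
      simp only [Function.comp_apply, zero_div, Real.tan_zero, altSeries_succ_zero] at h3
      exact h3.mono_left nhdsWithin_le_nhds
    · have : Continuous fun θ : ℝ => (θ - Real.pi / 2) ^ (m - r) / ((m - r).factorial : ℝ) := by
        fun_prop
      exact (this.tendsto 0).mono_left nhdsWithin_le_nhds
  simpa using h

/-- The factors (θ - π/2)^(m-r) kill all depths except r = m. The lower ones need only finite
limits, supplied by Abel's theorem. -/
theorem tendsto_primitive_right (m : ℕ) :
    Tendsto (primitive m) (𝓝[<] (Real.pi / 2)) (𝓝 (W (m + 1 + 1) (m + 1))) := by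
  have h : Tendsto (primitive m) (𝓝[<] (Real.pi / 2)) (𝓝 (∑ r ∈ Finset.range (m + 1),
      W (r + 1 + 1) (r + 1) *
        ((Real.pi / 2 - Real.pi / 2) ^ (m - r) / (m - r).factorial))) := by
    refine tendsto_finsetSum _ fun r _ => Tendsto.mul ?_ ?_
    · exact (tendsto_altSeries (tendsto_alternating_weightCoeff (by omega))).comp tendsto_tan_half
    · have : Continuous fun θ : ℝ => (θ - Real.pi / 2) ^ (m - r) / ((m - r).factorial : ℝ) := by
        fun_prop
      exact (this.tendsto _).mono_left nhdsWithin_le_nhds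
  convert h using 2
  rw [Finset.sum_range_succ, Finset.sum_eq_zero]
  · simp
  · intro r hr
    have := Finset.mem_range.1 hr
    rw [sub_self, zero_pow (by omega), zero_div, mul_zero]

/-- Evenness of the depth matches the signs of `hasDerivAt_primitive` with those of the kernel; only
one-sided limits at the endpoints are available. -/
theorem integral_kernelFun {p : ℕ} (hp : 1 ≤ p) :
    ∫ θ in (0 : ℝ)..(Real.pi / 2), kernelFun (2 * p) θ = W (2 * p + 1) (2 * p) := by
  obtain ⟨m, hm⟩ : ∃ m, 2 * p = m + 1 := ⟨2 * p - 1, by omega⟩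
  have heven : Even (m + 1) := hm ▸ even_two_mul p
  rw [hm, ← sub_zero (W _ _)]
  refine intervalIntegral.integral_eq_sub_of_hasDerivAt_of_tendsto (by positivity) (fun θ hθ => ?_)
    (intervalIntegrable_of_continuousOn_Icc (by positivity) (continuousOn_kernelFun _))
    (tendsto_primitive_left m) (tendsto_primitive_right m)
  refine (hasDerivAt_primitive hθ m).congr_deriv ?_
  have hsin := (Real.sin_pos_of_pos_of_lt_pi hθ.1 (by linarith [hθ.2, Real.pi_pos])).ne'
  rw [div_eq_iff hsin, kernelFun_mul_sin _ ⟨hθ.1.le, hθ.2.le⟩, heven.neg_pow,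
    ← neg_sub (Real.pi / 2) θ, heven.neg_pow]

/-- The Fourier cosine moments of the odd divided powers of `π/2 - θ`. -/
noncomputable def cosMoment (n k : ℕ) : ℝ :=
  ∫ θ in (0 : ℝ)..(Real.pi / 2), (Real.pi / 2 - θ) ^ n / n.factorial * Real.cos (k * θ)

theorem hasDerivAt_pi_div_two_sub_pow (n : ℕ) (θ : ℝ) :
    HasDerivAt (fun θ : ℝ => (Real.pi / 2 - θ) ^ (n + 1) / ((n + 1).factorial : ℝ))
      (-((Real.pi / 2 - θ) ^ n / n.factorial)) θ := by
  refine HasDerivAt.congr_deriv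
    ((((hasDerivAt_id θ).const_sub (Real.pi / 2)).pow (n + 1)).div_const
      ((n + 1).factorial : ℝ)) ?_
  rw [Nat.factorial_succ]
  push_cast
  have : (n : ℝ) + 1 ≠ 0 := by positivity
  simp
  field_simp

theorem hasDerivAt_sin_mul (k θ : ℝ) :
    HasDerivAt (fun θ : ℝ => Real.sin (k * θ)) (k * Real.cos (k * θ)) θ := by
  have h := (Real.hasDerivAt_sin (k * θ)).comp θ ((hasDerivAt_id θ).const_mul k)
  exact h.congr_deriv (by ring)

theorem hasDerivAt_cos_mul (k θ : ℝ) :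
    HasDerivAt (fun θ : ℝ => Real.cos (k * θ)) (-(k * Real.sin (k * θ))) θ := by
  have h := (Real.hasDerivAt_cos (k * θ)).comp θ ((hasDerivAt_id θ).const_mul k)
  exact h.congr_deriv (by ring)

/-- Two integrations by parts: the powers vanish at π/2 and the sine at 0, leaving one boundary
term. -/
theorem cosMoment_add_two (n : ℕ) {k : ℕ} (hk : k ≠ 0) :
    cosMoment (n + 2) k =
      ((Real.pi / 2) ^ (n + 1) / (n + 1).factorial - cosMoment n k) / k ^ 2 := by
  have hk' : (k : ℝ) ≠ 0 := Nat.cast_ne_zero.2 hk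
  have h := intervalIntegral.integral_eq_sub_of_hasDerivAt (a := 0) (b := Real.pi / 2)
    (fun θ _ => (((hasDerivAt_pi_div_two_sub_pow (n + 1) θ).mul (hasDerivAt_sin_mul k θ)).div_const
      (k : ℝ)).sub (((hasDerivAt_pi_div_two_sub_pow n θ).mul (hasDerivAt_cos_mul k θ)).div_const
      ((k : ℝ) ^ 2)))
    (Continuous.intervalIntegrable (by fun_prop) _ _)
  have h2 : cosMoment (n + 2) k + cosMoment n k / k ^ 2 =
      (Real.pi / 2) ^ (n + 1) / (n + 1).factorial / k ^ 2 := by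
    rw [cosMoment, cosMoment, ← intervalIntegral.integral_div, ← intervalIntegral.integral_add]
    · refine Eq.trans ?_ (h.trans ?_)
      · refine intervalIntegral.integral_congr fun θ _ => ?_
        field_simp
        ring
      · simp
    · exact Continuous.intervalIntegrable (by fun_prop) _ _
    · exact Continuous.intervalIntegrable (by fun_prop) _ _
  rw [sub_div, ← h2]
  ring

theorem cos_odd_mul_pi_div_two (q : ℕ) : Real.cos ((2 * q + 1 : ℕ) * (Real.pi / 2)) = 0 := by
  rw [Real.cos_eq_zero_iff]
  exact ⟨q, by push_cast; ring⟩

theorem cosMoment_one (q : ℕ) : cosMoment 1 (2 * q + 1) = 1 / ((2 * q + 1 : ℕ) : ℝ) ^ 2 := by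
  set k : ℕ := 2 * q + 1 with hk
  have hk' : (k : ℝ) ≠ 0 := Nat.cast_ne_zero.2 (by omega)
  have h := intervalIntegral.integral_eq_sub_of_hasDerivAt (a := 0) (b := Real.pi / 2)
    (fun θ _ => (((hasDerivAt_pi_div_two_sub_pow 0 θ).mul (hasDerivAt_sin_mul k θ)).div_const
      (k : ℝ)).sub ((hasDerivAt_cos_mul k θ).div_const ((k : ℝ) ^ 2)))
    (Continuous.intervalIntegrable (by fun_prop) _ _)
  refine Eq.trans ?_ (h.trans ?_)
  · refine intervalIntegral.integral_congr fun θ _ => ?_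
    simp
    field_simp
    ring
  · simp [hk, cos_odd_mul_pi_div_two q, -Nat.cast_add, -Nat.cast_mul]

theorem cosMoment_odd (m q : ℕ) :
    cosMoment (2 * m + 1) (2 * q + 1) = ∑ i ∈ Finset.range (m + 1),
      (-1) ^ i * ((Real.pi / 2) ^ (2 * (m - i)) / (2 * (m - i)).factorial) *
        (1 / ((2 * q + 1 : ℕ) : ℝ) ^ (2 * i + 2)) := by
  induction m with
  | zero => simp [cosMoment_one q, -Nat.cast_add, -Nat.cast_mul]
  | succ m ih =>
    rw [show 2 * (m + 1) + 1 = 2 * m + 1 + 2 by ring, cosMoment_add_two _ (by omega), ih,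
      Finset.sum_range_succ' _ (m + 1), sub_eq_neg_add, add_div, ← Finset.sum_neg_distrib,
      Finset.sum_div]
    congr 1
    · refine Finset.sum_congr rfl fun i _ => ?_
      rw [Nat.add_sub_add_right, show 2 * (i + 1) + 2 = 2 * i + 2 + 2 by ring, pow_add _ (2 * i + 2)]
      field_simp
      ring
    · rw [Nat.sub_zero, show 2 * m + 1 + 1 = 2 * (m + 1) by ring]
      ring

/-- Integration by parts without boundary terms: the power difference vanishes at 0, and the cosine
of an odd multiple vanishes at π/2. -/
theorem integral_mul_sin (n q : ℕ) :
    ∫ θ in (0 : ℝ)..(Real.pi / 2),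
      ((Real.pi / 2) ^ (n + 1) - (Real.pi / 2 - θ) ^ (n + 1)) / (n + 1).factorial *
        (2 * Real.sin ((2 * q + 1 : ℕ) * θ)) =
      2 / ((2 * q + 1 : ℕ) : ℝ) * cosMoment n (2 * q + 1) := by
  set k : ℕ := 2 * q + 1 with hk
  have hk' : (k : ℝ) ≠ 0 := Nat.cast_ne_zero.2 (by omega)
  have h := intervalIntegral.integral_eq_sub_of_hasDerivAt (a := 0) (b := Real.pi / 2)
    (fun θ _ => ((((hasDerivAt_pi_div_two_sub_pow n θ).sub_const
      ((Real.pi / 2) ^ (n + 1) / ((n + 1).factorial : ℝ))).mul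
        (hasDerivAt_cos_mul k θ)).const_mul (2 / (k : ℝ))))
    (Continuous.intervalIntegrable (by fun_prop) _ _)
  rw [cosMoment, ← intervalIntegral.integral_const_mul, ← sub_eq_zero,
    ← intervalIntegral.integral_sub]
  · refine Eq.trans ?_ (h.trans ?_)
    · refine intervalIntegral.integral_congr fun θ _ => ?_
      field_simp
      ring
    · simp [hk, cos_odd_mul_pi_div_two q, -Nat.cast_add, -Nat.cast_mul]
  · exact Continuous.intervalIntegrable (by fun_prop) _ _
  · exact Continuous.intervalIntegrable (by fun_prop) _ _

/-- By `sin_mul_sum_sin_odd` the N-th partial sum is the integral of the kernel times 1 - cos(2Nθ),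
and the cosine part tends to 0. -/
theorem tendsto_sum_cosMoment {p : ℕ} (hp : 1 ≤ p) :
    Tendsto (fun N => ∑ q ∈ Finset.range N,
      2 / ((2 * q + 1 : ℕ) : ℝ) * cosMoment (2 * p - 1) (2 * q + 1)) atTop
      (𝓝 (W (2 * p + 1) (2 * p))) := by
  have hpi : 0 ≤ Real.pi / 2 := by positivity
  have hg := continuousOn_kernelFun (2 * p)
  have h := (tendsto_integral_mul_cos hpi hg).const_sub (W (2 * p + 1) (2 * p))
  rw [sub_zero] at h
  refine h.congr fun N => ?_
  rw [← integral_kernelFun hp, ← intervalIntegral.integral_sub]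
  · simp only [← integral_mul_sin, Nat.sub_add_cancel (show 1 ≤ 2 * p by omega)]
    rw [← intervalIntegral.integral_finsetSum]
    · refine intervalIntegral.integral_congr fun θ hθ => ?_
      rw [Set.uIcc_of_le hpi] at hθ
      rw [← Finset.mul_sum, ← kernelFun_mul_sin _ hθ, mul_assoc (kernelFun _ _) (Real.sin θ),
        sin_mul_sum_sin_odd]
      ring
    · intro q _
      exact Continuous.intervalIntegrable (by fun_prop) _ _
  · exact intervalIntegrable_of_continuousOn_Icc hpi hg
  · exact intervalIntegrable_of_continuousOn_Icc hpi (hg.mul (by fun_prop))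

end Kernel

/-! ### Odd zeta values and the explicit formula -/

section Evaluation

theorem hasSum_odd_zeta {k : ℕ} (hk : 2 ≤ k) :
    HasSum (fun q : ℕ => 1 / ((2 * q + 1 : ℕ) : ℝ) ^ k) ((1 - 1 / 2 ^ k) * zetaVal k) := by
  have hs : Summable fun n : ℕ => 1 / (n : ℝ) ^ k :=
    Real.summable_one_div_nat_pow.2 (by omega)
  have h1 : Summable fun q : ℕ => 1 / ((2 * q : ℕ) : ℝ) ^ k :=
    hs.comp_injective (i := fun q : ℕ => 2 * q) fun a b h => by simpa using h
  have h2 : Summable fun q : ℕ => 1 / ((2 * q + 1 : ℕ) : ℝ) ^ k :=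
    hs.comp_injective (i := fun q : ℕ => 2 * q + 1) fun a b h => by simpa using h
  have h3 := tsum_even_add_odd (f := fun n : ℕ => 1 / (n : ℝ) ^ k) h1 h2
  have h4 : ∑' q : ℕ, 1 / ((2 * q : ℕ) : ℝ) ^ k = 1 / 2 ^ k * zetaVal k := by
    rw [zetaVal, ← tsum_mul_left]
    refine tsum_congr fun q => ?_
    push_cast
    rw [mul_pow]
    ring
  have h5 : ∑' q : ℕ, 1 / ((2 * q + 1 : ℕ) : ℝ) ^ k = (1 - 1 / 2 ^ k) * zetaVal k := by
    rw [sub_mul, one_mul, ← h4]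
    exact eq_sub_of_add_eq' h3
  rw [← h5]
  exact h2.hasSum

theorem W_eq_sum_zetaVal {p : ℕ} (hp : 1 ≤ p) :
    W (2 * p + 1) (2 * p) = ∑ i ∈ Finset.Icc 1 p, (-1) ^ (i - 1) *
      ((Real.pi / 2) ^ (2 * (p - i)) / (2 * (p - i)).factorial) *
        (2 * ((1 - 1 / 2 ^ (2 * i + 1)) * zetaVal (2 * i + 1))) := by
  refine tendsto_nhds_unique (tendsto_sum_cosMoment hp) ?_
  have h : Tendsto (fun N => ∑ i ∈ Finset.Icc 1 p, (-1) ^ (i - 1) *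
      ((Real.pi / 2) ^ (2 * (p - i)) / (2 * (p - i)).factorial) *
        (2 * ∑ q ∈ Finset.range N, 1 / ((2 * q + 1 : ℕ) : ℝ) ^ (2 * i + 1))) atTop
      (𝓝 (∑ i ∈ Finset.Icc 1 p, (-1) ^ (i - 1) *
      ((Real.pi / 2) ^ (2 * (p - i)) / (2 * (p - i)).factorial) *
        (2 * ((1 - 1 / 2 ^ (2 * i + 1)) * zetaVal (2 * i + 1))))) := by
    refine tendsto_finsetSum _ fun i hi => Tendsto.const_mul _ (Tendsto.const_mul _ ?_)
    have := (Finset.mem_Icc.1 hi).1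
    exact (hasSum_odd_zeta (by omega)).tendsto_sum_nat
  refine h.congr fun N => ?_
  obtain ⟨m, rfl⟩ : ∃ m, p = m + 1 := ⟨p - 1, by omega⟩
  simp only [Finset.mul_sum]
  rw [Finset.sum_comm]
  refine Finset.sum_congr rfl fun q _ => ?_
  rw [show 2 * (m + 1) - 1 = 2 * m + 1 by omega, cosMoment_odd, sum_Icc_one_eq_sum_range,
    Finset.mul_sum]
  refine Finset.sum_congr rfl fun i _ => ?_
  rw [Nat.add_sub_cancel, Nat.add_sub_add_right, show 2 * (i + 1) + 1 = 2 * i + 2 + 1 by ring,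
    pow_succ _ (2 * i + 2)]
  have : (((2 * q + 1 : ℕ) : ℝ)) ≠ 0 := Nat.cast_ne_zero.2 (by omega)
  field_simp

/-- With the double sum exchanged, the j-sum at fixed i is the cosine coefficient of
`sum_zetaBar_mul_Z`. It remains that (2^(2i+1) - 1)/2^(2i) = 2(1 - 2^(-(2i+1))) and that (-1)^(p-1)
(-1)^(p-i) = (-1)^(i-1). -/
theorem W_eq_sum_zetaBar_mul_Z {p : ℕ} (hp : 1 ≤ p) :
    W (2 * p + 1) (2 * p) =
      (-1 : ℝ) ^ (p - 1) * ∑ j ∈ Finset.Icc 1 p,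
        (1 / 2 ^ (2 * j - 1) * ∑ i ∈ Finset.Icc 1 j,
          (2 ^ (2 * i + 1) - 1) * zetaVal (2 * i + 1) * zetaBar (2 * j - 2 * i)) * Z j p := by
  have h1 : ∑ j ∈ Finset.Icc 1 p,
        (1 / 2 ^ (2 * j - 1) * ∑ i ∈ Finset.Icc 1 j,
          (2 ^ (2 * i + 1) - 1) * zetaVal (2 * i + 1) * zetaBar (2 * j - 2 * i)) * Z j p =
      ∑ i ∈ Finset.Icc 1 p, ∑ j ∈ Finset.Icc i p, (2 ^ (2 * i + 1) - 1) * zetaVal (2 * i + 1) *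
        (1 / 2 ^ (2 * j) * zetaBar (2 * j - 2 * i) * Z j p * 2) := by
    simp only [Finset.mul_sum, Finset.sum_mul]
    rw [Finset.sum_comm' (t' := Finset.Icc 1 p) (s' := fun i => Finset.Icc i p)]
    · refine Finset.sum_congr rfl fun i hi => Finset.sum_congr rfl fun j hj => ?_
      have h1 := Finset.mem_Icc.1 hi
      have h2 := Finset.mem_Icc.1 hj
      obtain ⟨a, rfl⟩ : ∃ a, j = a + 1 := ⟨j - 1, by omega⟩
      rw [show 2 * (a + 1) - 1 = 2 * a + 1 by omega,
        show 1 / (2 : ℝ) ^ (2 * (a + 1)) * zetaBar (2 * (a + 1) - 2 * i) * Z (a + 1) p * 2 =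
          1 / 2 ^ (2 * a + 1) * zetaBar (2 * (a + 1) - 2 * i) * Z (a + 1) p by
            rw [show 2 * (a + 1) = 2 * a + 1 + 1 by ring, pow_succ _ (2 * a + 1)]
            field_simp]
      ring
    · intro j i
      simp only [Finset.mem_Icc]
      omega
  rw [h1, W_eq_sum_zetaVal hp, Finset.mul_sum]
  refine Finset.sum_congr rfl fun i hi => ?_
  have hi' := Finset.mem_Icc.1 hi
  rw [← Finset.mul_sum, sum_zetaBar_mul_Z hi'.2]
  obtain ⟨a, rfl⟩ : ∃ a, i = a + 1 := ⟨i - 1, by omega⟩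
  obtain ⟨b, rfl⟩ : ∃ b, p = a + 1 + b := ⟨p - (a + 1), by omega⟩
  rw [show a + 1 + b - 1 = a + b by omega, Nat.add_sub_cancel_left, Nat.add_sub_cancel,
    pow_add (-1 : ℝ) a b, pow_succ _ (2 * (a + 1))]
  have hb : (-1 : ℝ) ^ b * (-1) ^ b = 1 := by rw [← mul_pow]; simp
  have h2 : (2 : ℝ) ^ (2 * (a + 1)) ≠ 0 := by positivity
  have h3 : ((2 * b).factorial : ℝ) ≠ 0 := Nat.cast_ne_zero.2 (Nat.factorial_ne_zero _)
  generalize (2 : ℝ) ^ (2 * (a + 1)) = u at *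
  generalize (Real.pi / 2) ^ (2 * b) = v at *
  generalize zetaVal (2 * (a + 1) + 1) = z at *
  calc (-1 : ℝ) ^ a * (v / (2 * b).factorial) * (2 * ((1 - 1 / (u * 2)) * z))
      = (-1 : ℝ) ^ a * (v / (2 * b).factorial) * ((u * 2 - 1) / u * z) := by
        field_simp
    _ = (-1 : ℝ) ^ a * ((-1 : ℝ) ^ b * (-1) ^ b) * (v / (2 * b).factorial) *
          ((u * 2 - 1) / u * z) := by rw [hb, mul_one]
    _ = _ := by ring

theorem W_mem_adjoin {p : ℕ} (hp : 1 ≤ p) :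
    W (2 * p + 1) (2 * p) ∈
      Algebra.adjoin ℚ ({x : ℝ | ∃ k : ℕ, 2 ≤ k ∧ x = zetaVal k} ∪
        {x : ℝ | ∃ k : ℕ, 1 ≤ k ∧ x = zetaBar k}) := by
  set A := Algebra.adjoin ℚ ({x : ℝ | ∃ k : ℕ, 2 ≤ k ∧ x = zetaVal k} ∪
        {x : ℝ | ∃ k : ℕ, 1 ≤ k ∧ x = zetaBar k}) with hA
  have hQ : ∀ q : ℚ, (q : ℝ) ∈ A := fun q => A.algebraMap_mem q
  have hz : ∀ k, 2 ≤ k → zetaVal k ∈ A := fun k hk =>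
    Algebra.subset_adjoin (Or.inl ⟨k, hk, rfl⟩)
  have hb : ∀ n, zetaBar n ∈ A := by
    intro n
    rcases Nat.eq_zero_or_pos n with rfl | hn
    · have := hQ (1 / 2)
      simpa [zetaBar] using this
    · exact Algebra.subset_adjoin (Or.inr ⟨n, hn, rfl⟩)
  rw [W_eq_sum_zetaBar_mul_Z hp]
  refine A.mul_mem (A.pow_mem (A.neg_mem A.one_mem) _) (A.sum_mem fun j _ =>
    A.mul_mem (A.mul_mem ?_ (A.sum_mem fun i hi => A.mul_mem (A.mul_mem ?_ (hz _ ?_)) (hb _)))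
      (Z_mem hb _ _))
  · have := hQ (1 / 2 ^ (2 * j - 1))
    push_cast at this
    exact this
  · have := hQ (2 ^ (2 * i + 1) - 1)
    push_cast at this
    exact this
  · have := (Finset.mem_Icc.1 hi).1
    omega

end Evaluation

end AltMTV

theorem corollary3p5 (p : ℕ) (hp : 1 ≤ p) :
    (∀ κ ∈ AltMTV.indices (2 * p + 1) (2 * p),
      Tendsto (AltMTV.tBarPartial κ) atTop (𝓝 (AltMTV.tBar κ))) ∧
    AltMTV.W (2 * p + 1) (2 * p) ∈
      Algebra.adjoin ℚ ({x : ℝ | ∃ k : ℕ, 2 ≤ k ∧ x = AltMTV.zetaVal k} ∪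
        {x : ℝ | ∃ k : ℕ, 1 ≤ k ∧ x = AltMTV.zetaBar k}) ∧
    AltMTV.W (2 * p + 1) (2 * p) =
      (-1 : ℝ) ^ (p - 1) * ∑ j ∈ Finset.Icc 1 p,
        (1 / 2 ^ (2 * j - 1) * ∑ i ∈ Finset.Icc 1 j,
          (2 ^ (2 * i + 1) - 1) * AltMTV.zetaVal (2 * i + 1) * AltMTV.zetaBar (2 * j - 2 * i)) *
          AltMTV.Z j p :=
  ⟨fun _ hκ => AltMTV.tendsto_tBarPartial (by omega) hκ, AltMTV.W_mem_adjoin hp,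
    AltMTV.W_eq_sum_zetaBar_mul_Z hp⟩
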